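/- Let $N\ge 1$, let $L$ be a positive divisor of $N$, let $0\le B\le N/2$, and let $i\in\mathbb Z/N$. All signals are $N$-periodic, $\hat z_k=\sum_{n=0}^{N-1} z_n e^{-2\pi\iota kn/N}$, and indices are taken modulo $N$. A signal $x\in\mathbb C^N$ is $B$-bandlimited with band $i,\dots,i+B-1$ if $\hat x_{i+j}=0$ for $B\le j<N$. Its FROG trace is $$|\hat y_{k,m}|^2=\Bigl|\sum_{n=0}^{N-1}x_nx_{n+mL}e^{-2\pi\iota kn/N}\Bigr|^2 .$$ Two signals are equivalent up to trivial ambiguities if one arises from the other by a global phase $x\mapsto e^{\iota\varphi}x$ ($\varphi\in\mathbb R$), a continuous translation $\hat x_k\mapsto e^{\iota\psi k}\hat x_k$ ($\psi\in\mathbb R$, where $k$ is represented by the consecutive integers $i,\dots,i+N-1$, $0\le i<N$), and possibly the reflection $x_n\mapsto\overline{x_{-n}}$. A property holds for generic signals with band $i,\dots,i+B-1$ if the signals with this band that violate it lie in the zero locus of a nonzero real polynomial in the real and imaginary parts of $\hat x_i,\dots,\hat x_{i+B-1}$. 1. Suppose $N/L\ge 4$. There is a set of at most $3B$ index pairs $(k,m)$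 with $m\in\{0,1,2\}$, depending only on $N,L,B,i$, such that a generic signal $x$ with band $i,\dots,i+B-1$ is determined, up to trivial ambiguities, among all signals with the same band by the $3B$ (or fewer) measurements $|\hat y_{k,m}|^2$ at these pairs. Moreover, a generic such $x$ is determined, up to trivial ambiguities, by its FROG trace at all $k$ and at $m=0,1,2$ among all $B$-bandlimited signals whose band $j,\dots,j+B-1$ is arbitrary, except that $j=i+N/2$ is excluded when $N$ is even. 2. Suppose $N/L\ge 3$. There is a set of at most $2B$ index pairs $(k,m)$ with $m\in\{0,1\}$, depending only on $N,L,B,i$, such that a generic signal $x$ with band $i,\dots,i+B-1$ is determined, up to trivial ambiguities, among all signals in $\mathbb C^N$ by its power spectrum $(|\hat x_k|)_k$ and the $2B$ (or fewer) measurements $|\hat y_{k,m}|^2$ at these pairs. -/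

import Mathlib

noncomputable section

/-- The FROG trace of an `N`-periodic signal with step `L`: the squared modulus at frequency `k` of
the discrete Fourier transform of `n ↦ x n * x (n + m * L)`. -/
def frogTrace {N : ℕ} [NeZero N] (L : ℕ) (x : ZMod N → ℂ) (k : ZMod N) (m : ℕ) : ℝ :=
  ‖ZMod.dft (fun n : ZMod N => x n * x (n + ((m * L : ℕ) : ZMod N))) k‖ ^ 2

/-- `x` is bandlimited to the band `i, i + 1, …, i + B - 1` (modulo `N`): the remaining `N - B`
consecutive Fourier coefficients vanish. -/
def IsBandlimitedAt {N : ℕ} [NeZero N] (B : ℕ) (i : ZMod N) (x : ZMod N → ℂ) : Prop :=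
  ∀ j : ℕ, B ≤ j → j < N → ZMod.dft x (i + (j : ZMod N)) = 0

/-- Global rotation by the phase `φ`. -/
def rotateSignal {N : ℕ} (φ : ℝ) (x : ZMod N → ℂ) : ZMod N → ℂ :=
  fun n => Complex.exp (Complex.I * φ) * x n

/-- The representative of the frequency `k` among the consecutive integers
`i, i + 1, …, i + N - 1`, where `0 ≤ i < N`. -/
def liftedFreq {N : ℕ} (i k : ZMod N) : ℕ :=
  i.val + (k - i).val

/-- Continuous translation of signals with a band that starts at `i`: the Fourier coefficient at
the (lifted) frequency `k` is multiplied by `exp (I * ψ * k)`. -/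
def translateSignal {N : ℕ} [NeZero N] (i : ZMod N) (ψ : ℝ) (x : ZMod N → ℂ) : ZMod N → ℂ :=
  ZMod.dft.symm fun k => Complex.exp (Complex.I * ψ * (liftedFreq i k : ℂ)) * ZMod.dft x k

/-- Reflection with conjugation. -/
def reflectSignal {N : ℕ} (x : ZMod N → ℂ) : ZMod N → ℂ :=
  fun n => (starRingEnd ℂ) (x (-n))

/-- `z` is obtained from `x` by the trivial ambiguities: a global phase, a continuous translation
(for the band that starts at `i`), and possibly the reflection. -/
def TriviallyEquivalent {N : ℕ} [NeZero N] (i : ZMod N) (x z : ZMod N → ℂ) : Prop :=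
  ∃ φ ψ : ℝ, z = rotateSignal φ (translateSignal i ψ x) ∨ z = rotateSignal φ (translateSignal i ψ (reflectSignal x))

/-- The real and the imaginary parts of the `B` Fourier coefficients in the band. -/
def bandCoords {N : ℕ} [NeZero N] (B : ℕ) (i : ZMod N) (x : ZMod N → ℂ) : Fin B ⊕ Fin B → ℝ :=
  Sum.elim (fun j => (ZMod.dft x (i + ((j : ℕ) : ZMod N))).re)
    (fun j => (ZMod.dft x (i + ((j : ℕ) : ZMod N))).im)

/-- The property `Q` holds for generic signals with the band `i, …, i + B - 1`: the signals of that
band that violate it lie in the zero locus of a nonzero real polynomial in the real and imaginary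
parts of the `B` free Fourier coefficients. -/
def HoldsGenerically {N : ℕ} [NeZero N] (B : ℕ) (i : ZMod N) (Q : (ZMod N → ℂ) → Prop) : Prop :=
  ∃ P : MvPolynomial (Fin B ⊕ Fin B) ℝ, P ≠ 0 ∧
    ∀ x : ZMod N → ℂ, IsBandlimitedAt B i x → ¬ Q x →
      MvPolynomial.eval (bandCoords B i x) P = 0

end

/-!
The Fourier coefficients `a j` of a signal in its band turn the FROG trace at frequency `2 i + s` into
the modulus of the quadratic form `∑ cos (π m (s - 2 j) / r) a j a (s - j)` with `r = N / L`
(`frogTrace_eq`); since `2 B ≤ N`, no frequency wraps around. In the form of degree `s` the coefficient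
`a s` occurs only in the leading term `2 cos (π m s / r) a 0 a s`. Once the earlier coefficients are
known, each modulus therefore prescribes the distance of `a s` from a centre: `a s` lies on a circle.
The power spectrum contributes a circle about `0`. Two circles leave two candidates, and three circles
with non-collinear centres leave one. The trivial ambiguities fix `a 0` and `a 1` from their moduli and
choose between the two candidates for `a 2` (`exists_polynomial_determined_up_to`).

In some degrees only two circles are available: for `s = 3`, and where a leading cosine vanishes. The
third condition then comes from a larger degree `t = s + 1` or `t = s + 2`. If a form of degree `t` has
no leading term, it involves `a s` but nothing later. Otherwise `a t` is generic over all earlier data,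
and three circles in degree `t` that are satisfied by a generic point and by a second solution have
congruent triangles of centres (`sum_mul_sum_eq_of_generic`). Hence the modulus of a combination of the
forms in which the leading term cancels is known as well. `Resolvable` lists these possibilities, and
`resolvable_frogCoeff` and `resolvable_spectrumCoeff` check them for the two kinds of measurements.

"Generic" is made precise algebraically. Conjugates are treated as independent variables `a' j`, the
squared moduli becoming products `H(a) H(a')`, and the argument is carried out over a field that
contains a point with algebraically independent coordinates `a j, a' j` together with an arbitrary
second solution (`eq_genSeq_of_truncForm_mul_eq`). Two circles keep the second solution algebraic over
the generic coordinates of no larger index (`mem_tower_of_twoCircles`), so genericity of `a t` is not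
lost. If uniqueness failed on a Zariski dense set of signals, a prime ideal avoiding the relevant
multiplicative set would yield a field in which it fails at a generic point
(`exists_polynomial_of_generic`).

If the band of the second signal is unknown, the trace at `m = 0` of a generic signal does not vanish
on an arc of length `2 B - 1` that starts at `2 i`, and the trace of a signal with band at `j` vanishes
off the arc of the same length at `2 j`. Hence `2 j = 2 i` (`two_mul_eq_of_frogTrace_ne_zero`).
-/

/-! ### Truncated quadratic forms -/

/-- The part of the quadratic form `∑ c j * a j * a (t - j)` of degree `t` with `p ≤ j ≤ t - p`. For
`p = 1` this is the form without the leading term `2 * c 0 * a 0 * a t`. -/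
def truncForm {R : Type*} [CommRing R] [Algebra ℝ R] (c : ℕ → ℝ) (t p : ℕ) (a : ℕ → R) : R :=
  ∑ j ∈ Finset.Ico p (t + 1 - p), c j • (a j * a (t - j))

section truncForm

variable {R : Type*} [CommRing R] [Algebra ℝ R]

lemma truncForm_eq_add {c : ℕ → ℝ} {t p : ℕ} (hp : 2 * p < t) (hc : c (t - p) = c p)
    (a : ℕ → R) :
    truncForm c t p a = (2 * c p) • (a p * a (t - p)) + truncForm c t (p + 1) a := by
  unfold truncForm
  rw [Finset.sum_eq_sum_Ico_succ_bot (by omega), show t + 1 - p = (t - p) + 1 by omega,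
    Finset.sum_Ico_succ_top (by omega), hc, show t - (t - p) = p by omega,
    show t + 1 - (p + 1) = t - p by omega, mul_comm (a (t - p)), two_mul, add_smul]
  abel

lemma map_truncForm {R' : Type*} [CommRing R'] [Algebra ℝ R'] (f : R →ₐ[ℝ] R') (c : ℕ → ℝ)
    (t p : ℕ) (a : ℕ → R) : f (truncForm c t p a) = truncForm c t p (fun j => f (a j)) := by
  simp [truncForm, map_sum]

lemma truncForm_congr {c : ℕ → ℝ} {t p : ℕ} {a b : ℕ → R}
    (h : ∀ j, p ≤ j → j + p ≤ t → a j = b j) : truncForm c t p a = truncForm c t p b := by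
  unfold truncForm
  refine Finset.sum_congr rfl fun j hj => ?_
  rw [Finset.mem_Ico] at hj
  rw [h j (by omega) (by omega), h (t - j) (by omega) (by omega)]

lemma truncForm_eq_zero {c : ℕ → ℝ} {t p : ℕ} {a : ℕ → R}
    (h : ∀ j, p ≤ j → j + p ≤ t → c j = 0) : truncForm c t p a = 0 := by
  unfold truncForm
  refine Finset.sum_eq_zero fun j hj => ?_
  rw [Finset.mem_Ico] at hj
  rw [h j (by omega) (by omega), zero_smul]

lemma truncForm_sum {ι : Type*} [Fintype ι] (l : ι → ℝ) (c : ι → ℕ → ℝ) (t p : ℕ) (a : ℕ → R) :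
    truncForm (fun j => ∑ m, l m * c m j) t p a = ∑ m, l m • truncForm (c m) t p a := by
  simp only [truncForm, Finset.sum_smul, Finset.smul_sum, smul_smul]
  rw [Finset.sum_comm]

/-- A sequence whose products `a j * a (t - j)` single out `{q, t - q}` evaluates the form to a
nonzero multiple of `c q`, the multiple not depending on `c`. -/
lemma exists_truncForm_eq_mul {t p q : ℕ} {a : ℕ → ℝ} (hq : p ≤ q) (hqt : q + p ≤ t)
    (ha : ∀ j, p ≤ j → j + p ≤ t → a j * a (t - j) = if j = q ∨ j = t - q then 1 else 0) :
    ∃ n : ℝ, n ≠ 0 ∧ ∀ c : ℕ → ℝ, c (t - q) = c q → truncForm c t p a = n * c q := by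
  classical
  refine ⟨(((Finset.Ico p (t + 1 - p)).filter (fun j => j = q ∨ j = t - q)).card : ℝ), ?_, ?_⟩
  · have : q ∈ (Finset.Ico p (t + 1 - p)).filter (fun j => j = q ∨ j = t - q) := by
      simp; omega
    exact_mod_cast Finset.card_ne_zero_of_mem this
  · intro c hc
    unfold truncForm
    rw [← nsmul_eq_mul, ← Finset.sum_const, Finset.sum_filter]
    refine Finset.sum_congr rfl fun j hj => ?_
    rw [Finset.mem_Ico] at hj
    rw [ha j (by omega) (by omega)]
    split_ifs with h
    · rcases h with h | h <;> simp [h, hc]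
    · simp

lemma truncForm_mem {L : Type*} [Field L] [Algebra ℝ L] (K : IntermediateField ℝ L) {c : ℕ → ℝ}
    {t p : ℕ} {a : ℕ → L} (h : ∀ j, p ≤ j → j + p ≤ t → a j ∈ K) : truncForm c t p a ∈ K := by
  unfold truncForm
  refine sum_mem fun j hj => K.smul_mem (mul_mem ?_ ?_)
  · rw [Finset.mem_Ico] at hj; exact h j (by omega) (by omega)
  · rw [Finset.mem_Ico] at hj; exact h (t - j) (by omega) (by omega)

end truncForm

/-! ### Congruence of the centres at a generic point -/

/-- `x` and `x'` satisfy no nontrivial quadratic relation over `K`. -/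
def QuadIndependent (K : Type*) {L : Type*} [Field K] [Field L] [Algebra K L] (x x' : L) : Prop :=
  ∀ A B C D E F : K, algebraMap K L A * x ^ 2 + algebraMap K L B * (x * x') +
    algebraMap K L C * x' ^ 2 + algebraMap K L D * x + algebraMap K L E * x' +
    algebraMap K L F = 0 → A = 0 ∧ B = 0 ∧ C = 0 ∧ D = 0 ∧ E = 0 ∧ F = 0

section Congruence

variable {K L : Type*} [Field K] [Field L] [Algebra K L]

/-- Over `K`, an invertible system of three equations whose right sides are affine in `x, x'` is
solved by affine expressions in `x, x'`. -/
lemma exists_affine_solution {x x' : L} {M : Matrix (Fin 3) (Fin 3) K} (hM : M.det ≠ 0)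
    {f g k : Fin 3 → K} {z : Fin 3 → L}
    (h : ∀ μ, algebraMap K L (M μ 0) * z 0 + algebraMap K L (M μ 1) * z 1 +
      algebraMap K L (M μ 2) * z 2 =
      algebraMap K L (f μ) * x + algebraMap K L (g μ) * x' + algebraMap K L (k μ)) :
    ∃ P Q E : Fin 3 → K, (∀ μ, f μ = M μ 0 * P 0 + M μ 1 * P 1 + M μ 2 * P 2) ∧
      (∀ μ, g μ = M μ 0 * Q 0 + M μ 1 * Q 1 + M μ 2 * Q 2) ∧
      ∀ i, z i = algebraMap K L (P i) * x + algebraMap K L (Q i) * x' + algebraMap K L (E i) := by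
  have hunit : IsUnit M.det := isUnit_iff_ne_zero.mpr hM
  have solve : ∀ W : Fin 3 → K, ∃ T : Fin 3 → K,
      ∀ μ, W μ = M μ 0 * T 0 + M μ 1 * T 1 + M μ 2 * T 2 := by
    intro W
    refine ⟨M⁻¹.mulVec W, fun μ => ?_⟩
    have : (M.mulVec (M⁻¹.mulVec W)) μ = W μ := by
      rw [Matrix.mulVec_mulVec, Matrix.mul_nonsing_inv _ hunit, Matrix.one_mulVec]
    rw [← this, Matrix.mulVec, dotProduct, Fin.sum_univ_three]
  obtain ⟨P, hP⟩ := solve f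
  obtain ⟨Q, hQ⟩ := solve g
  obtain ⟨E, hE⟩ := solve k
  refine ⟨P, Q, E, hP, hQ, ?_⟩
  have sol : (fun i => z i - (algebraMap K L (P i) * x +
      algebraMap K L (Q i) * x' + algebraMap K L (E i))) = (0 : Fin 3 → L) := by
    refine Matrix.eq_zero_of_mulVec_eq_zero (M := M.map (algebraMap K L)) ?_ ?_
    · rw [← RingHom.mapMatrix_apply, ← RingHom.map_det]
      simpa using hM
    · ext μ
      have := h μ
      rw [hP μ, hQ μ, hE μ] at this
      simp only [map_add, map_mul] at this
      simp only [Matrix.mulVec, dotProduct, Fin.sum_univ_three, Matrix.map_apply, Pi.zero_apply]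
      linear_combination this
  intro i
  exact sub_eq_zero.mp (congrFun sol i)

/-- If `(α x + V)(α x' + V') = (α y + U)(α y' + U')` for three triples and a generic pair
`(x, x')`, then the map `(x, x') ↦ (y, y')` is a formal isometry; it carries differences of the
centres `V / α` to those of the centres `U / α`. -/
lemma sum_mul_sum_eq_of_generic {x x' y y' : L} (hx : QuadIndependent K x x')
    {α V V' U U' : Fin 3 → K} (hα : ∀ μ, α μ ≠ 0)
    (hdet : Matrix.det (Matrix.of fun μ => ![α μ, V' μ, V μ]) ≠ 0)
    (h : ∀ μ, (algebraMap K L (α μ) * x + algebraMap K L (V μ)) *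
        (algebraMap K L (α μ) * x' + algebraMap K L (V' μ)) =
      (algebraMap K L (α μ) * y + algebraMap K L (U μ)) *
        (algebraMap K L (α μ) * y' + algebraMap K L (U' μ)))
    {l : Fin 3 → K} (hl : ∑ μ, l μ * α μ = 0) :
    (∑ μ, l μ * V μ) * (∑ μ, l μ * V' μ) = (∑ μ, l μ * U μ) * (∑ μ, l μ * U' μ) := by
  -- each equation is linear in the unknowns `y * y' - x * x'`, `y`, `y'`
  set k : Fin 3 → K := fun μ => (V μ * V' μ - U μ * U' μ) / α μ with hk
  have hlin : ∀ μ, algebraMap K L (α μ) * (y * y' - x * x') + algebraMap K L (U' μ) * y +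
      algebraMap K L (U μ) * y' =
      algebraMap K L (V' μ) * x + algebraMap K L (V μ) * x' + algebraMap K L (k μ) := by
    intro μ
    have hα' : algebraMap K L (α μ) ≠ 0 := by simpa using hα μ
    have hkμ : algebraMap K L (α μ) * algebraMap K L (k μ) =
        algebraMap K L (V μ) * algebraMap K L (V' μ) -
          algebraMap K L (U μ) * algebraMap K L (U' μ) := by
      rw [← map_mul, hk]
      simp only
      rw [mul_div_cancel₀ _ (hα μ), map_sub, map_mul, map_mul]
    apply mul_left_cancel₀ hα'
    linear_combination -h μ - hkμ
  set M : Matrix (Fin 3) (Fin 3) K := Matrix.of fun μ => ![α μ, U' μ, U μ] with hM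
  -- a linear dependence among the rows would be a relation between `x` and `x'` over `K`
  have hMdet : M.det ≠ 0 := by
    intro h0
    obtain ⟨v, hv0, hv⟩ := Matrix.exists_vecMul_eq_zero_iff.mpr h0
    have h1 := congrFun hv 0
    have h2 := congrFun hv 1
    have h3 := congrFun hv 2
    simp only [Matrix.vecMul, dotProduct, Fin.sum_univ_three, hM, Matrix.of_apply,
      Matrix.cons_val, Pi.zero_apply] at h1 h2 h3
    have h1' := congrArg (algebraMap K L) h1
    have h2' := congrArg (algebraMap K L) h2
    have h3' := congrArg (algebraMap K L) h3
    simp only [map_add, map_mul, map_zero] at h1' h2' h3'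
    obtain ⟨-, -, -, hD, hE, -⟩ := hx 0 0 0 (v 0 * V' 0 + v 1 * V' 1 + v 2 * V' 2)
      (v 0 * V 0 + v 1 * V 1 + v 2 * V 2) (v 0 * k 0 + v 1 * k 1 + v 2 * k 2) (by
        simp only [map_add, map_mul, map_zero]
        linear_combination -algebraMap K L (v 0) * hlin 0 - algebraMap K L (v 1) * hlin 1 -
          algebraMap K L (v 2) * hlin 2 + (y * y' - x * x') * h1' + y * h2' + y' * h3')
    apply hdet
    refine Matrix.exists_vecMul_eq_zero_iff.mp ⟨v, hv0, ?_⟩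
    ext i
    fin_cases i <;>
      simp only [Matrix.vecMul, dotProduct, Fin.sum_univ_three, Matrix.of_apply, Matrix.cons_val,
        Pi.zero_apply, Fin.zero_eta, Fin.mk_one, Fin.reduceFinMk] <;> assumption
  -- hence `y`, `y'` and their product are affine in `x, x'`; comparing the product of the first two
  -- with the third gives the coefficients of an isometry
  obtain ⟨P, Q, E, hP', hQ', hs⟩ := exists_affine_solution (x := x) (x' := x') (f := V') (g := V)
    (k := k) (z := ![y * y' - x * x', y, y']) hMdet hlin
  have s0 : y * y' - x * x' = _ := hs 0
  have s1 : y = _ := hs 1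
  have s2 : y' = _ := hs 2
  replace hP' : ∀ μ, V' μ = α μ * P 0 + U' μ * P 1 + U μ * P 2 := hP'
  replace hQ' : ∀ μ, V μ = α μ * Q 0 + U' μ * Q 1 + U μ * Q 2 := hQ'
  obtain ⟨c1, c2, c3, -, -, -⟩ := hx (P 1 * P 2) (P 1 * Q 2 + Q 1 * P 2 - 1) (Q 1 * Q 2)
    (P 1 * E 2 + E 1 * P 2 - P 0) (Q 1 * E 2 + E 1 * Q 2 - Q 0) (E 1 * E 2 - E 0) (by
      simp only [map_add, map_sub, map_mul, map_one]
      rw [s1, s2] at s0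
      linear_combination s0)
  have eV' : ∑ μ, l μ * V' μ = P 1 * (∑ μ, l μ * U' μ) + P 2 * ∑ μ, l μ * U μ := by
    simp only [Fin.sum_univ_three] at hl ⊢
    rw [hP' 0, hP' 1, hP' 2]
    linear_combination P 0 * hl
  have eV : ∑ μ, l μ * V μ = Q 1 * (∑ μ, l μ * U' μ) + Q 2 * ∑ μ, l μ * U μ := by
    simp only [Fin.sum_univ_three] at hl ⊢
    rw [hQ' 0, hQ' 1, hQ' 2]
    linear_combination Q 0 * hl
  have z1 : P 1 * Q 1 = 0 ∧ P 2 * Q 2 = 0 := by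
    rcases mul_eq_zero.mp c1 with h1 | h1 <;> rcases mul_eq_zero.mp c3 with h2 | h2 <;>
      simp_all
  rw [eV, eV']
  linear_combination (∑ μ, l μ * U' μ) ^ 2 * z1.1 + (∑ μ, l μ * U μ) ^ 2 * z1.2 +
    (∑ μ, l μ * U' μ) * (∑ μ, l μ * U μ) * c2

end Congruence

/-! ### Fields generated by a generic point -/

lemma QuadIndependent.of_algebraicIndependent {K L : Type*} [Field K] [CharZero K] [Field L]
    [Algebra K L] {ι : Type*} {z : ι → L} (hz : AlgebraicIndependent K z) {i j : ι} (hij : i ≠ j) :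
    QuadIndependent K (z i) (z j) := by
  classical
  intro A B C D E F h
  have hp : MvPolynomial.aeval z (MvPolynomial.C A * MvPolynomial.X i ^ 2 +
      MvPolynomial.C B * (MvPolynomial.X i * MvPolynomial.X j) +
      MvPolynomial.C C * MvPolynomial.X j ^ 2 + MvPolynomial.C D * MvPolynomial.X i +
      MvPolynomial.C E * MvPolynomial.X j + MvPolynomial.C F : MvPolynomial ι K) = 0 := by
    simpa using h
  have hp0 := (injective_iff_map_eq_zero _).mp hz _ hp
  have ev : ∀ s t : K, A * s ^ 2 + B * (s * t) + C * t ^ 2 + D * s + E * t + F = 0 := by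
    intro s t
    have := congrArg (MvPolynomial.eval (Function.update (fun _ => t) i s)) hp0
    simpa [Function.update_of_ne hij.symm] using this
  have e00 := ev 0 0
  have e10 := ev 1 0
  have e20 := ev (-1) 0
  have e01 := ev 0 1
  have e02 := ev 0 (-1)
  have e11 := ev 1 1
  have two : (2 : K) ≠ 0 := two_ne_zero
  have hF : F = 0 := by linear_combination e00
  have hA : A = 0 := by
    apply (mul_eq_zero.mp (show (2 : K) * A = 0 by linear_combination e10 + e20 - 2 * e00)).resolve_left two
  have hC : C = 0 := by
    apply (mul_eq_zero.mp (show (2 : K) * C = 0 by linear_combination e01 + e02 - 2 * e00)).resolve_left two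
  have hD : D = 0 := by linear_combination e10 - hA - hF
  have hE : E = 0 := by linear_combination e01 - hC - hF
  have hB : B = 0 := by linear_combination e11 - hA - hC - hD - hE - hF
  exact ⟨hA, hB, hC, hD, hE, hF⟩

/-- `K` is a tower of fields adapted to the sequences `a, a'` up to index `B`: each `K s` is closed
under roots of quadratic equations (`C ≠ 0` excludes the zero equation), contains `a j, a' j` for `j < s`, and `a s, a' s` are generic
over it. -/
structure GenericTower {L : Type*} [Field L] [Algebra ℝ L] (B : ℕ) (a a' : ℕ → L)
    (K : ℕ → IntermediateField ℝ L) : Prop where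
  mono : Monotone K
  mem : ∀ j < B, a j ∈ K (j + 1)
  mem' : ∀ j < B, a' j ∈ K (j + 1)
  root : ∀ s, ∀ A ∈ K s, ∀ D ∈ K s, ∀ C ∈ K s, C ≠ 0 →
    ∀ y, A * y ^ 2 + D * y + C = 0 → y ∈ K s
  indep : ∀ s < B, QuadIndependent (K s) (a s) (a' s)

/-- For algebraically independent `a j, a' j` one takes for `K s` the relative algebraic closure of
the field generated by the terms of index less than `s`. -/
lemma exists_genericTower {L : Type*} [Field L] [Algebra ℝ L] {B : ℕ} {a a' : ℕ → L}
    (h : AlgebraicIndependent ℝ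
      (Sum.elim (fun j : Fin B => a j) (fun j : Fin B => a' j))) :
    ∃ K : ℕ → IntermediateField ℝ L, GenericTower B a a' K := by
  set x : Fin B ⊕ Fin B → L := Sum.elim (fun j : Fin B => a j) (fun j : Fin B => a' j) with hx
  let T : ℕ → Set (Fin B ⊕ Fin B) := fun s => {i | (Sum.elim id id i : Fin B).val < s}
  let F : ℕ → IntermediateField ℝ L := fun s => IntermediateField.adjoin ℝ (x '' T s)
  have hmem : ∀ s i, i ∈ T s → x i ∈ (algebraicClosure (F s) L).restrictScalars ℝ := by
    intro s i hi
    rw [IntermediateField.mem_restrictScalars, mem_algebraicClosure_iff]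
    exact isAlgebraic_algebraMap
      (⟨x i, IntermediateField.subset_adjoin _ _ ⟨i, hi, rfl⟩⟩ : F s)
  refine ⟨fun s => (algebraicClosure (F s) L).restrictScalars ℝ, ?_, ?_, ?_, ?_, ?_⟩
  · intro s t hst y hy
    rw [IntermediateField.mem_restrictScalars, mem_algebraicClosure_iff] at hy ⊢
    have hle : F s ≤ F t := IntermediateField.adjoin.mono _ _ _
      (Set.image_mono fun i (hi : _ < s) => (lt_of_lt_of_le hi hst : _ < t))
    let _ : Algebra (F s) (F t) := (IntermediateField.inclusion hle).toAlgebra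
    have : IsScalarTower (F s) (F t) L := IsScalarTower.of_algebraMap_eq fun _ => rfl
    exact hy.tower_top (F t)
  · intro j hj
    exact hmem (j + 1) (Sum.inl ⟨j, hj⟩) (Nat.lt_succ_self j)
  · intro j hj
    exact hmem (j + 1) (Sum.inr ⟨j, hj⟩) (Nat.lt_succ_self j)
  · intro s A hA B hB C hC hC0 y hy
    rw [IntermediateField.mem_restrictScalars] at hA hB hC ⊢
    have : IsAlgebraic (algebraicClosure (F s) L) y := by
      refine ⟨Polynomial.C ⟨A, hA⟩ * Polynomial.X ^ 2 + Polynomial.C ⟨B, hB⟩ * Polynomial.X +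
        Polynomial.C ⟨C, hC⟩, ?_, ?_⟩
      · intro h0
        have := congrArg (fun p => Polynomial.coeff p 0) h0
        simp at this
        exact hC0 (congrArg Subtype.val this)
      · simp
        exact hy
    have h2 : y ∈ algebraicClosure (algebraicClosure (F s) L) L := mem_algebraicClosure_iff.mpr this
    rw [algebraicClosure.algebraicClosure_eq_bot] at h2
    obtain ⟨w, rfl⟩ := IntermediateField.mem_bot.mp h2
    exact w.2
  · intro s hs
    have hd : Disjoint (T s) ({Sum.inl ⟨s, hs⟩, Sum.inr ⟨s, hs⟩} : Set (Fin B ⊕ Fin B)) := by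
      rw [Set.disjoint_left]
      rintro i (hi : _ < s) (rfl | rfl) <;> simp at hi
    have h1 := h.adjoin_of_disjoint hd
    have h2 : AlgebraicIndependent (F s) _ := IntermediateField.algebraicIndependent_adjoin_iff.mpr h1
    have h3 := h2.algebraicClosure
    have := QuadIndependent.of_algebraicIndependent h3
      (i := ⟨Sum.inl ⟨s, hs⟩, by simp⟩) (j := ⟨Sum.inr ⟨s, hs⟩, by simp⟩) (by simp)
    exact this

namespace GenericTower

variable {L : Type*} [Field L] [Algebra ℝ L] {B : ℕ} {a a' : ℕ → L}
  {K : ℕ → IntermediateField ℝ L}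

lemma mem_of_lt (hK : GenericTower B a a' K) {j s : ℕ} (hj : j < B) (hs : j < s) : a j ∈ K s :=
  hK.mono hs (hK.mem j hj)

lemma mem_of_lt' (hK : GenericTower B a a' K) {j s : ℕ} (hj : j < B) (hs : j < s) : a' j ∈ K s :=
  hK.mono hs (hK.mem' j hj)

lemma affine (hK : GenericTower B a a' K) {s : ℕ} (hs : s < B) {D E F : L} (hD : D ∈ K s)
    (hE : E ∈ K s) (hF : F ∈ K s) (h : D * a s + E * a' s + F = 0) : D = 0 ∧ E = 0 ∧ F = 0 := by
  obtain ⟨-, -, -, h1, h2, h3⟩ := hK.indep s hs 0 0 0 ⟨D, hD⟩ ⟨E, hE⟩ ⟨F, hF⟩ (by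
    simp only [map_zero, zero_mul, zero_add]; exact h)
  exact ⟨congrArg Subtype.val h1, congrArg Subtype.val h2, congrArg Subtype.val h3⟩

lemma product_ne_zero (hK : GenericTower B a a' K) {s : ℕ} (hs : s < B) {r r' w w' : L}
    (hr : r ∈ K s) (hr' : r' ∈ K s) (hr0 : r ≠ 0) (hr0' : r' ≠ 0)
    (hw : w ∈ K s) (hw' : w' ∈ K s) : (r * a s + w) * (r' * a' s + w') ≠ 0 := by
  intro h
  rcases mul_eq_zero.mp h with h | h
  · exact hr0 (hK.affine hs hr (zero_mem _) hw (by linear_combination h)).1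
  · exact hr0' (hK.affine hs (zero_mem _) hr' hw' (by linear_combination h)).2.1

/-- Two circle equations with distinct centres that hold at the generic point force a further
solution `(y, y')` to be algebraic over the preceding data. -/
lemma mem_of_two_circles (hK : GenericTower B a a' K) {s : ℕ} (hs : s < B)
    {r r' y y' w w' v v' u u' t t' : L} (hr : r ∈ K s) (hr' : r' ∈ K s) (hr0 : r ≠ 0)
    (hr0' : r' ≠ 0) (hw : w ∈ K s) (hw' : w' ∈ K s) (hv : v ∈ K s) (hv' : v' ∈ K s)
    (hu : u ∈ K s) (hu' : u' ∈ K s) (ht : t ∈ K s) (ht' : t' ∈ K s) (hwv : w ≠ v)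
    (h1 : (r * a s + w) * (r' * a' s + w') = (r * y + u) * (r' * y' + u'))
    (h2 : (r * a s + v) * (r' * a' s + v') = (r * y + t) * (r' * y' + t')) :
    y ∈ K (s + 1) ∧ y' ∈ K (s + 1) := by
  have up : ∀ {z : L}, z ∈ K s → z ∈ K (s + 1) := fun hz => hK.mono (Nat.le_succ s) hz
  have ha := hK.mem s hs
  have ha' := hK.mem' s hs
  set h := (r * a s + w) * (r' * a' s + w') with hh
  have hne : h ≠ 0 := hK.product_ne_zero hs hr hr' hr0 hr0' hw hw'
  have hmem : h ∈ K (s + 1) := mul_mem (add_mem (mul_mem (up hr) ha) (up hw))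
    (add_mem (mul_mem (up hr') ha') (up hw'))
  set h' := (r * a s + v) * (r' * a' s + v') with hh'
  have hmem' : h' ∈ K (s + 1) := mul_mem (add_mem (mul_mem (up hr) ha) (up hv))
    (add_mem (mul_mem (up hr') ha') (up hv'))
  -- in the coordinates `Y, Y'` centred at the first centre the equations are `Y * Y' = h` and
  -- `Y * d' + Y' * d = g`
  set Y := r * y + u with hY
  set Y' := r' * y' + u' with hY'
  set d := t - u with hd
  set d' := t' - u' with hd'
  set g := h' - h - d * d' with hg
  have hdm : d ∈ K (s + 1) := sub_mem (up ht) (up hu)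
  have hdm' : d' ∈ K (s + 1) := sub_mem (up ht') (up hu')
  have hgm : g ∈ K (s + 1) := sub_mem (sub_mem hmem' hmem) (mul_mem hdm hdm')
  have lin : Y * d' + Y' * d = g := by
    rw [hg, h1, h2, hd, hd', hY, hY']; ring
  have key : Y ∈ K (s + 1) ∧ Y' ∈ K (s + 1) := by
    by_cases hd0 : d = 0
    · by_cases hd0' : d' = 0
      · exfalso
        have hz : (r * a s + w) * (r' * a' s + w') = (r * a s + v) * (r' * a' s + v') := by
          have : h' - h = 0 := by
            have := lin
            rw [hg, hd0, hd0'] at this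
            linear_combination -this
          rw [← hh, ← hh']
          linear_combination -this
        have := (hK.affine hs (D := r * (w' - v')) (E := r' * (w - v)) (F := w * w' - v * v')
          (mul_mem hr (sub_mem hw' hv')) (mul_mem hr' (sub_mem hw hv))
          (sub_mem (mul_mem hw hw') (mul_mem hv hv')) (by linear_combination hz)).2.1
        rcases mul_eq_zero.mp this with h0 | h0
        · exact hr0' h0
        · exact hwv (sub_eq_zero.mp h0)
      · have e : Y = g / d' := by
          rw [eq_div_iff hd0', ← lin, hd0]; ring
        have hYm : Y ∈ K (s + 1) := e ▸ div_mem hgm hdm'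
        have hY0 : Y ≠ 0 := fun h0 => hne (by rw [h1, h0, zero_mul])
        refine ⟨hYm, ?_⟩
        have : Y' = h / Y := by rw [eq_div_iff hY0, h1]; ring
        exact this ▸ div_mem hmem hYm
    · have hYm : Y ∈ K (s + 1) := by
        refine hK.root (s + 1) d' hdm' (-g) (neg_mem hgm) (h * d) (mul_mem hmem hdm)
          (mul_ne_zero hne hd0) Y ?_
        rw [h1, ← lin]; ring
      refine ⟨hYm, ?_⟩
      have : Y' = (g - Y * d') / d := by rw [eq_div_iff hd0, ← lin]; ring
      exact this ▸ div_mem (sub_mem hgm (mul_mem hYm hdm')) hdm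
  refine ⟨?_, ?_⟩
  · have : y = (Y - u) / r := by rw [eq_div_iff hr0, hY]; ring
    exact this ▸ div_mem (sub_mem key.1 (up hu)) (up hr)
  · have : y' = (Y' - u') / r' := by rw [eq_div_iff hr0', hY']; ring
    exact this ▸ div_mem (sub_mem key.2 (up hu')) (up hr')

end GenericTower

/-! ### Determinants of the linear systems for one coefficient -/

lemma QuadIndependent.mul {K L : Type*} [Field K] [Field L] [Algebra K L] {x x' : L}
    (h : QuadIndependent K x x') {r r' : K} (hr : r ≠ 0) (hr' : r' ≠ 0) :
    QuadIndependent K (algebraMap K L r * x) (algebraMap K L r' * x') := by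
  intro A B C D E F h0
  obtain ⟨h1, h2, h3, h4, h5, h6⟩ := h (A * r ^ 2) (B * (r * r')) (C * r' ^ 2) (D * r) (E * r') F (by
    simp only [map_mul, map_pow]
    linear_combination h0)
  simp only [mul_eq_zero, pow_eq_zero_iff, ne_eq, OfNat.ofNat_ne_zero, not_false_eq_true, hr, hr',
    or_false] at h1 h2 h3 h4 h5
  exact ⟨h1, h2, h3, h4, h5, h6⟩

section formRow

variable {R : Type*} [CommRing R] [Algebra ℝ R]

/-- If `u = (2 * e p) • (a p * x) + truncForm e t (p + 1) a` is linear in an unknown `x`, then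
prescribing `u * u'` is a linear condition on the increments of `x * x'`, `x` and `x'`; this is its
coefficient vector. -/
def formRow (e : ℕ → ℝ) (t p : ℕ) (a a' : ℕ → R) : Fin 3 → R :=
  ![(2 * e p) • (a p * a' p), a p * truncForm e t (p + 1) a', a' p * truncForm e t (p + 1) a]

lemma map_formRow {R' : Type*} [CommRing R'] [Algebra ℝ R'] (f : R →ₐ[ℝ] R') (e : ℕ → ℝ)
    (t p : ℕ) (a a' : ℕ → R) (i : Fin 3) :
    f (formRow e t p a a' i) = formRow e t p (fun j => f (a j)) (fun j => f (a' j)) i := by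
  fin_cases i <;> simp [formRow, map_truncForm]

end formRow

/-- Three independent conditions determine the coefficient of index `s`. -/
lemma eq_of_det_formRow_ne_zero {L : Type*} [Field L] [Algebra ℝ L] {a a' b b' : ℕ → L} {s : ℕ}
    {e : Fin 3 → ℕ → ℝ} {t p : Fin 3 → ℕ} (hp : ∀ μ, t μ = s + p μ) (hps : ∀ μ, 2 * p μ < t μ)
    (hps' : ∀ μ, p μ < s) (hsymm : ∀ μ j, j ≤ t μ → e μ (t μ - j) = e μ j)
    (he : ∀ μ, e μ (p μ) ≠ 0)
    (hdet : Matrix.det (Matrix.of fun μ => formRow (e μ) (t μ) (p μ) a a') ≠ 0)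
    (hlt : ∀ j < s, b j = a j ∧ b' j = a' j)
    (h : ∀ μ, truncForm (e μ) (t μ) (p μ) a * truncForm (e μ) (t μ) (p μ) a' =
      truncForm (e μ) (t μ) (p μ) b * truncForm (e μ) (t μ) (p μ) b') :
    b s = a s ∧ b' s = a' s := by
  have key : (![b s * b' s - a s * a' s, b s - a s, b' s - a' s] : Fin 3 → L) = 0 := by
    refine Matrix.eq_zero_of_mulVec_eq_zero hdet ?_
    ext μ
    have hμ := h μ
    have e1 : ∀ z : ℕ → L, truncForm (e μ) (t μ) (p μ) z =
        (2 * e μ (p μ)) • (z (p μ) * z s) + truncForm (e μ) (t μ) (p μ + 1) z := by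
      intro z
      rw [truncForm_eq_add (hps μ) (hsymm μ _ (by have := hps μ; omega)),
        show t μ - p μ = s by have := hp μ; omega]
    rw [e1 a, e1 a', e1 b, e1 b', (hlt _ (hps' μ)).1, (hlt _ (hps' μ)).2,
      truncForm_congr (a := b) (b := a) (fun j _ hj => (hlt j (by have := hp μ; omega)).1),
      truncForm_congr (a := b') (b := a') (fun j _ hj => (hlt j (by have := hp μ; omega)).2)] at hμ
    have h2 : algebraMap ℝ L (2 * e μ (p μ)) ≠ 0 := by
      simpa using he μ
    simp only [Matrix.mulVec, dotProduct, Fin.sum_univ_three, formRow, Matrix.of_apply,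
      Matrix.cons_val, Pi.zero_apply]
    simp only [Algebra.smul_def] at hμ ⊢
    apply mul_left_cancel₀ h2
    linear_combination -hμ
  have k1 := congrFun key 1
  have k2 := congrFun key 2
  simp only [Matrix.cons_val, Pi.zero_apply, sub_eq_zero] at k1 k2
  exact ⟨k1, k2⟩

/-- The coordinates of the first family of variables, extended by zero. -/
noncomputable def genSeq (B : ℕ) (j : ℕ) : MvPolynomial (Fin B ⊕ Fin B) ℝ :=
  if h : j < B then MvPolynomial.X (Sum.inl ⟨j, h⟩) else 0

/-- The coordinates of the second family of variables, extended by zero; they play the role of the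
complex conjugates of the first. -/
noncomputable def genSeq' (B : ℕ) (j : ℕ) : MvPolynomial (Fin B ⊕ Fin B) ℝ :=
  if h : j < B then MvPolynomial.X (Sum.inr ⟨j, h⟩) else 0

/-- Evaluation of the two families of variables at two real sequences. -/
noncomputable def specialize (B : ℕ) (z z' : ℕ → ℝ) : MvPolynomial (Fin B ⊕ Fin B) ℝ →ₐ[ℝ] ℝ :=
  MvPolynomial.aeval (Sum.elim (fun j => z j) (fun j => z' j))

lemma specialize_genSeq {B : ℕ} {z : ℕ → ℝ} (hz : ∀ j, B ≤ j → z j = 0) (z' : ℕ → ℝ) (j : ℕ) :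
    specialize B z z' (genSeq B j) = z j := by
  unfold specialize genSeq
  split_ifs with h
  · simp
  · simp [hz j (by omega)]

lemma specialize_genSeq' {B : ℕ} (z : ℕ → ℝ) {z' : ℕ → ℝ} (hz' : ∀ j, B ≤ j → z' j = 0) (j : ℕ) :
    specialize B z z' (genSeq' B j) = z' j := by
  unfold specialize genSeq'
  split_ifs with h
  · simp
  · simp [hz' j (by omega)]

section Nonvanishing

variable {L : Type*} [Field L] [Algebra ℝ L] {B : ℕ}
  {f : MvPolynomial (Fin B ⊕ Fin B) ℝ →ₐ[ℝ] L}

lemma det_formRow_ne_zero (hf : Function.Injective f) {e : Fin 3 → ℕ → ℝ} {t p : Fin 3 → ℕ}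
    {z z' : ℕ → ℝ} (hz : ∀ j, B ≤ j → z j = 0) (hz' : ∀ j, B ≤ j → z' j = 0)
    (h : Matrix.det (Matrix.of fun μ => formRow (e μ) (t μ) (p μ) z z') ≠ 0) :
    Matrix.det (Matrix.of fun μ => formRow (e μ) (t μ) (p μ) (fun j => f (genSeq B j))
      (fun j => f (genSeq' B j))) ≠ 0 := by
  set M : Matrix (Fin 3) (Fin 3) (MvPolynomial (Fin B ⊕ Fin B) ℝ) :=
    Matrix.of fun μ => formRow (e μ) (t μ) (p μ) (genSeq B) (genSeq' B) with hM
  have h1 : Matrix.det (Matrix.of fun μ => formRow (e μ) (t μ) (p μ) (fun j => f (genSeq B j))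
      (fun j => f (genSeq' B j))) = f M.det := by
    rw [AlgHom.map_det]
    congr 1
    ext μ i
    simp [hM, map_formRow]
  have h2 : Matrix.det (Matrix.of fun μ => formRow (e μ) (t μ) (p μ) z z') =
      specialize B z z' M.det := by
    rw [AlgHom.map_det]
    congr 1
    ext μ i
    simp [hM, map_formRow, specialize_genSeq hz, specialize_genSeq' z hz']
  rw [h1]
  intro h0
  rw [map_eq_zero_iff f hf] at h0
  rw [h2, h0, map_zero] at h
  exact h rfl

/-- Indicator sequence of a list of indices. -/
def indicatorSeq (l : List ℕ) (j : ℕ) : ℝ := if j ∈ l then 1 else 0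

lemma indicatorSeq_eq_zero {l : List ℕ} (hl : ∀ j ∈ l, j < B) : ∀ j, B ≤ j → indicatorSeq l j = 0 := by
  intro j hj
  rw [indicatorSeq, if_neg]
  intro h
  have := hl j h
  omega

lemma exists_truncForm_indicatorSeq {t p k q : ℕ} (hk : p ≤ k) (hkt : k + p ≤ t) (hq : 2 * q ≠ t)
    (hp : 1 ≤ p) :
    ∃ n : ℝ, n ≠ 0 ∧ ∀ c : ℕ → ℝ, c (t - k) = c k →
      truncForm c t p (indicatorSeq [0, q, k, t - k]) = n * c k := by
  apply exists_truncForm_eq_mul hk hkt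
  intro j hj hjt
  simp only [indicatorSeq, List.mem_cons, List.not_mem_nil, or_false]
  split_ifs <;> first | (norm_num; done) | (exfalso; omega)

lemma truncForm_ne_zero (hf : Function.Injective f) {e : ℕ → ℝ} {t p k : ℕ} (hp : 1 ≤ p)
    (hk : p ≤ k) (hkt : k + p ≤ t) (hkB : k < B) (htB : t - k < B) (hsymm : e (t - k) = e k)
    (he : e k ≠ 0) : truncForm e t p (fun j => f (genSeq B j)) ≠ 0 := by
  obtain ⟨n, hn, h⟩ := exists_truncForm_indicatorSeq (q := 0) hk hkt (by omega) hp
  have hz := indicatorSeq_eq_zero (B := B) (l := [0, 0, k, t - k]) (by simp; omega)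
  rw [← map_truncForm f]
  intro h0
  rw [map_eq_zero_iff f hf] at h0
  have h1 := congrArg (specialize B (indicatorSeq [0, 0, k, t - k]) 0) h0
  rw [map_truncForm, map_zero] at h1
  simp only [specialize_genSeq hz] at h1
  rw [h e hsymm] at h1
  exact mul_ne_zero hn he h1

end Nonvanishing

/-! ### Uniqueness at the generic point -/

/-- The forms `μ, ν` of degree `s` contain the leading term `a 0 * a s` and are not proportional:
as functions of `a s` their moduli measure distances from two distinct centres. -/
def TwoCircles (c : Fin 3 → ℕ → ℕ → ℝ) (μ ν : Fin 3) (s : ℕ) : Prop :=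
  c μ s 0 ≠ 0 ∧ c ν s 0 ≠ 0 ∧ ∃ k, 1 ≤ k ∧ k < s ∧ c μ s k * c ν s 0 ≠ c ν s k * c μ s 0

/-- All three forms of degree `s` contain the leading term `a 0 * a s`, and the three centres are
generically not collinear. -/
def ThreeCircles (c : Fin 3 → ℕ → ℕ → ℝ) (s : ℕ) : Prop :=
  (∀ μ, c μ s 0 ≠ 0) ∧ ∃ k l, (1 ≤ k ∧ k < s) ∧ (1 ≤ l ∧ l < s) ∧
    Matrix.det (Matrix.of fun μ => ![c μ s 0, c μ s k, c μ s l]) ≠ 0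

/-- The form with coefficients `e` of degree `t` has no leading term `a 0 * a t`, and its modulus is
determined by the measurements: either it is itself one of the three forms (where for `t = B` the
leading term is absent because `a B = 0`), or three circles are available in degree `t` and the
leading term cancels in a linear combination of the forms. -/
def LeadingTermFree (B : ℕ) (c : Fin 3 → ℕ → ℕ → ℝ) (t : ℕ) (e : ℕ → ℝ) : Prop :=
  (∃ κ, e = c κ t ∧ (t < B → e 0 = 0)) ∨
    (t < B ∧ ThreeCircles c t ∧ e 0 = 0 ∧ ∃ l : Fin 3 → ℝ, e = fun j => ∑ μ, l μ * c μ t j)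

/-- The coefficient of index `s` is determined by those of smaller index: by three circles, or by
two circles and a form `e` of larger degree `s + p`, starting with the term `a p * a s`, so that
`a s` is the coefficient of highest index in it. The last alternative makes the resulting three
linear conditions independent: `e` has a further term, or the tails of the two forms of degree `s`
are not proportional. -/
def Resolvable (B : ℕ) (c : Fin 3 → ℕ → ℕ → ℝ) (s : ℕ) : Prop :=
  ThreeCircles c s ∨ ∃ μ ν p e, TwoCircles c μ ν s ∧ 1 ≤ p ∧ 2 * p < s ∧ s + p ≤ B ∧
    LeadingTermFree B c (s + p) e ∧ e p ≠ 0 ∧ (∀ j, 1 ≤ j → j < p → e j = 0) ∧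
    ((∃ q, p < q ∧ q < s ∧ e q ≠ 0) ∨
      ∃ k l, (1 ≤ k ∧ k < s) ∧ (1 ≤ l ∧ l < s) ∧ c μ s k * c ν s l ≠ c μ s l * c ν s k)

lemma truncForm_one_eq {R : Type*} [CommRing R] [Algebra ℝ R] {e : ℕ → ℝ} {t p : ℕ}
    (hp : 1 ≤ p) (hpt : 2 * p < t) (hsymm : ∀ j, j ≤ t → e (t - j) = e j)
    (h : ∀ j, 1 ≤ j → j < p → e j = 0) (a : ℕ → R) : truncForm e t 1 a = truncForm e t p a := by
  induction p, hp using Nat.le_induction with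
  | base => rfl
  | succ p hp ih =>
    rw [ih (by omega) fun j h1 h2 => h j h1 (by omega),
      truncForm_eq_add (by omega) (hsymm p (by omega)), h p hp (by omega)]
    simp

section GenericPoint

variable {L : Type*} [Field L] [Algebra ℝ L] {B : ℕ}
  {f : MvPolynomial (Fin B ⊕ Fin B) ℝ →ₐ[ℝ] L} {c : Fin 3 → ℕ → ℕ → ℝ}

lemma ThreeCircles.det_ne_zero (hf : Function.Injective f) {s : ℕ} (hs : s < B)
    (hsymm : ∀ μ s j, j ≤ s → c μ s (s - j) = c μ s j) (h : ThreeCircles c s) :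
    Matrix.det (Matrix.of fun μ => formRow (c μ s) s 0 (fun j => f (genSeq B j))
      (fun j => f (genSeq' B j))) ≠ 0 := by
  obtain ⟨-, k, l, hk, hl, hdet⟩ := h
  obtain ⟨n, hn, hn'⟩ := exists_truncForm_indicatorSeq (t := s) (p := 1) (k := k) (q := 0)
    hk.1 (by omega) (by omega) le_rfl
  obtain ⟨m, hm, hm'⟩ := exists_truncForm_indicatorSeq (t := s) (p := 1) (k := l) (q := 0)
    hl.1 (by omega) (by omega) le_rfl
  refine det_formRow_ne_zero hf (z := indicatorSeq [0, 0, l, s - l])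
    (z' := indicatorSeq [0, 0, k, s - k]) (indicatorSeq_eq_zero (by simp; omega))
    (indicatorSeq_eq_zero (by simp; omega)) (e := fun μ => c μ s) (t := fun _ => s)
    (p := fun _ => 0) ?_
  have i0 : ∀ k, indicatorSeq [0, 0, k, s - k] 0 = 1 := by intro k; simp [indicatorSeq]
  have e1 : ∀ μ, truncForm (c μ s) s 1 (indicatorSeq [0, 0, k, s - k]) = n * c μ s k :=
    fun μ => hn' _ (hsymm μ s k (by omega))
  have e2 : ∀ μ, truncForm (c μ s) s 1 (indicatorSeq [0, 0, l, s - l]) = m * c μ s l :=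
    fun μ => hm' _ (hsymm μ s l (by omega))
  have : Matrix.det (Matrix.of fun μ => formRow (c μ s) s 0 (indicatorSeq [0, 0, l, s - l])
      (indicatorSeq [0, 0, k, s - k])) =
      2 * n * m * Matrix.det (Matrix.of fun μ => ![c μ s 0, c μ s k, c μ s l]) := by
    simp only [Matrix.det_fin_three, Matrix.of_apply, formRow, Matrix.cons_val, zero_add, e1, e2,
      i0, smul_eq_mul]
    ring
  rw [this]
  exact mul_ne_zero (mul_ne_zero (mul_ne_zero two_ne_zero hn) hm) hdet

/-- The determinant of the linear system for the index `s` is a nonzero polynomial. If `e` has a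
further term, evaluation at a point with `a' p = 0` leaves one entry in the third row, whose minor
expresses that the two centres are distinct; otherwise the third row has the first entry only, whose
minor expresses that the tails of the two forms of degree `s` are not proportional. -/
lemma TwoCircles.det_ne_zero (hf : Function.Injective f) {s p : ℕ} {μ ν : Fin 3} {e : ℕ → ℝ}
    (hsymm : ∀ μ s j, j ≤ s → c μ s (s - j) = c μ s j) (h : TwoCircles c μ ν s)
    (hp : 1 ≤ p) (hps : 2 * p < s) (hsB : s < B)
    (he : ∀ j, j ≤ s + p → e (s + p - j) = e j) (hep : e p ≠ 0)
    (hq : (∃ q, p < q ∧ q < s ∧ e q ≠ 0) ∨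
      ∃ k l, (1 ≤ k ∧ k < s) ∧ (1 ≤ l ∧ l < s) ∧ c μ s k * c ν s l ≠ c μ s l * c ν s k) :
    Matrix.det (Matrix.of fun i => formRow ((![c μ s, c ν s, e] : Fin 3 → ℕ → ℝ) i)
      ((![s, s, s + p] : Fin 3 → ℕ) i) ((![0, 0, p] : Fin 3 → ℕ) i) (fun j => f (genSeq B j))
      (fun j => f (genSeq' B j))) ≠ 0 := by
  obtain ⟨hμ0, hν0, k, hk1, hks, hk⟩ := h
  by_cases hq' : ∃ q, p < q ∧ q < s ∧ e q ≠ 0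
  · obtain ⟨q, hpq, hqs, heq⟩ := hq'
    obtain ⟨n, hn, hn'⟩ := exists_truncForm_indicatorSeq (t := s) (p := 1) (k := k) (q := p)
      hk1 (by omega) (by omega) le_rfl
    obtain ⟨m, hm, hm'⟩ := exists_truncForm_indicatorSeq (t := s + p) (p := p + 1) (k := q) (q := 0)
      (by omega) (by omega) (by omega) (by omega)
    refine det_formRow_ne_zero hf (z := indicatorSeq [0, p, k, s - k])
      (z' := indicatorSeq [0, 0, q, s + p - q]) (indicatorSeq_eq_zero (by simp; omega))
      (indicatorSeq_eq_zero (by simp; omega)) ?_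
    have i0 : ∀ q t, indicatorSeq [0, 0, q, t] 0 = 1 := by intro q t; simp [indicatorSeq]
    have i0' : ∀ q t, indicatorSeq [0, p, q, t] 0 = 1 := by intro q t; simp [indicatorSeq]
    have ip : indicatorSeq [0, 0, q, s + p - q] p = 0 := by
      simp only [indicatorSeq, List.mem_cons, List.not_mem_nil, or_false]
      rw [if_neg (by omega)]
    have ip' : indicatorSeq [0, p, k, s - k] p = 1 := by simp [indicatorSeq]
    have e1 := hn' _ (hsymm μ s k (by omega))
    have e2 := hn' _ (hsymm ν s k (by omega))
    have e3 := hm' e (he q (by omega))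
    simp only [Matrix.det_fin_three, Matrix.of_apply, formRow, Matrix.cons_val, zero_add, e1, e2,
      e3, i0, i0', ip, ip', smul_eq_mul]
    have : m * e q * (2 * n) * (c μ s k * c ν s 0 - c ν s k * c μ s 0) ≠ 0 :=
      mul_ne_zero (mul_ne_zero (mul_ne_zero hm heq) (mul_ne_zero two_ne_zero hn)) (sub_ne_zero.mpr hk)
    convert this using 1
    ring
  · obtain ⟨k, l, hk, hl, hkl⟩ := hq.resolve_left hq'
    push Not at hq'
    obtain ⟨n, hn, hn'⟩ := exists_truncForm_indicatorSeq (t := s) (p := 1) (k := k) (q := p)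
      hk.1 (by omega) (by omega) le_rfl
    obtain ⟨m, hm, hm'⟩ := exists_truncForm_indicatorSeq (t := s) (p := 1) (k := l) (q := p)
      hl.1 (by omega) (by omega) le_rfl
    refine det_formRow_ne_zero hf (z := indicatorSeq [0, p, l, s - l])
      (z' := indicatorSeq [0, p, k, s - k]) (indicatorSeq_eq_zero (by simp; omega))
      (indicatorSeq_eq_zero (by simp; omega)) ?_
    have i0 : ∀ q t, indicatorSeq [0, p, q, t] 0 = 1 := by intro q t; simp [indicatorSeq]
    have ip : ∀ q t, indicatorSeq [0, p, q, t] p = 1 := by intro q t; simp [indicatorSeq]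
    have e1 := hn' _ (hsymm μ s k (by omega))
    have e2 := hn' _ (hsymm ν s k (by omega))
    have e3 := hm' _ (hsymm μ s l (by omega))
    have e4 := hm' _ (hsymm ν s l (by omega))
    have e0 : ∀ z : ℕ → ℝ, truncForm e (s + p) (p + 1) z = 0 := fun z =>
      truncForm_eq_zero fun j h1 h2 => hq' j (by omega) (by omega)
    simp only [Matrix.det_fin_three, Matrix.of_apply, formRow, Matrix.cons_val, zero_add, e1, e2,
      e3, e4, e0, i0, ip, smul_eq_mul]
    have : 2 * e p * (n * m) * (c μ s k * c ν s l - c μ s l * c ν s k) ≠ 0 :=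
      mul_ne_zero (mul_ne_zero (mul_ne_zero two_ne_zero hep) (mul_ne_zero hn hm))
        (sub_ne_zero.mpr hkl)
    convert this using 1
    ring

lemma algebraicIndependent_genSeq (hf : Function.Injective f) :
    AlgebraicIndependent ℝ (Sum.elim (fun j : Fin B => f (genSeq B j))
      (fun j : Fin B => f (genSeq' B j))) := by
  have h : Sum.elim (fun j : Fin B => f (genSeq B j)) (fun j : Fin B => f (genSeq' B j)) =
      fun i => f (MvPolynomial.X i) := by
    funext i
    rcases i with i | i <;> simp [genSeq, genSeq']
  rw [h]
  exact (MvPolynomial.algebraicIndependent_X (Fin B ⊕ Fin B) ℝ).map' hf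

/-- A further solution `b, b'` of the measurement equations at the generic point is algebraic over
the generic point, index by index. -/
lemma mem_tower_of_twoCircles (hf : Function.Injective f)
    (hsymm : ∀ μ s j, j ≤ s → c μ s (s - j) = c μ s j)
    {K : ℕ → IntermediateField ℝ L}
    (hK : GenericTower B (fun j => f (genSeq B j)) (fun j => f (genSeq' B j)) K)
    {b b' : ℕ → L} (hb : ∀ j < 3, b j = f (genSeq B j) ∧ b' j = f (genSeq' B j))
    (htwo : ∀ s, 3 ≤ s → s < B → ∃ μ ν, TwoCircles c μ ν s)
    (heq : ∀ s, 3 ≤ s → s < B → ∀ μ, truncForm (c μ s) s 0 (fun j => f (genSeq B j)) *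
      truncForm (c μ s) s 0 (fun j => f (genSeq' B j)) =
      truncForm (c μ s) s 0 b * truncForm (c μ s) s 0 b') :
    ∀ s < B, b s ∈ K (s + 1) ∧ b' s ∈ K (s + 1) := by
  intro s
  induction s using Nat.strong_induction_on with
  | _ s ih =>
  intro hs
  set a := fun j => f (genSeq B j) with ha
  set a' := fun j => f (genSeq' B j) with ha'
  by_cases h3 : s < 3
  · rw [(hb s h3).1, (hb s h3).2]
    exact ⟨hK.mem s hs, hK.mem' s hs⟩
  push Not at h3
  obtain ⟨μ, ν, hμ0, hν0, k, hk1, hks, hk⟩ := htwo s h3 hs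
  have hgen : ∀ j < B, genSeq B j ≠ 0 ∧ genSeq' B j ≠ 0 := by
    intro j hj
    simp [genSeq, genSeq', hj, MvPolynomial.X_ne_zero]
  have ha0 : a 0 ≠ 0 := by
    rw [ha]; simp only [ne_eq, map_eq_zero_iff f hf]; exact (hgen 0 (by omega)).1
  have ha0' : a' 0 ≠ 0 := by
    rw [ha']; simp only [ne_eq, map_eq_zero_iff f hf]; exact (hgen 0 (by omega)).2
  have hbm : ∀ j, 1 ≤ j → j + 1 ≤ s → b j ∈ K s := fun j _ hj =>
    hK.mono (show j + 1 ≤ s from hj) (ih j (by omega) (by omega)).1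
  have hbm' : ∀ j, 1 ≤ j → j + 1 ≤ s → b' j ∈ K s := fun j _ hj =>
    hK.mono (show j + 1 ≤ s from hj) (ih j (by omega) (by omega)).2
  have ham : ∀ j, 1 ≤ j → j + 1 ≤ s → a j ∈ K s := fun j _ hj =>
    hK.mem_of_lt (by omega) (by omega)
  have ham' : ∀ j, 1 ≤ j → j + 1 ≤ s → a' j ∈ K s := fun j _ hj =>
    hK.mem_of_lt' (by omega) (by omega)
  have two : (2 : L) ≠ 0 := by
    have : CharZero L := charZero_of_injective_algebraMap (algebraMap ℝ L).injective
    exact two_ne_zero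
  have hform : ∀ κ, c κ s 0 ≠ 0 → ∀ z : ℕ → L, truncForm (c κ s) s 0 z =
      algebraMap ℝ L (c κ s 0) * (2 * z 0 * z s + (c κ s 0)⁻¹ • truncForm (c κ s) s 1 z) := by
    intro κ hκ z
    rw [truncForm_eq_add (by omega) (hsymm κ s 0 (by omega))]
    have : algebraMap ℝ L (c κ s 0) ≠ 0 := by simpa using hκ
    simp only [Algebra.smul_def, map_mul, map_inv₀, map_ofNat, Nat.sub_zero, zero_add]
    field_simp
  have hcirc : ∀ κ, c κ s 0 ≠ 0 →
      (2 * a 0 * a s + (c κ s 0)⁻¹ • truncForm (c κ s) s 1 a) *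
        (2 * a' 0 * a' s + (c κ s 0)⁻¹ • truncForm (c κ s) s 1 a') =
      (2 * a 0 * b s + (c κ s 0)⁻¹ • truncForm (c κ s) s 1 b) *
        (2 * a' 0 * b' s + (c κ s 0)⁻¹ • truncForm (c κ s) s 1 b') := by
    intro κ hκ
    have h := heq s h3 hs κ
    have hκ' : algebraMap ℝ L (c κ s 0) ≠ 0 := by simpa using hκ
    rw [hform κ hκ, hform κ hκ, hform κ hκ, hform κ hκ, (hb 0 (by omega)).1,
      (hb 0 (by omega)).2] at h
    apply mul_left_cancel₀ (mul_ne_zero hκ' hκ')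
    linear_combination h
  refine hK.mem_of_two_circles hs (r := 2 * a 0) (r' := 2 * a' 0)
    (mul_mem (by simp) (hK.mem_of_lt (by omega) (by omega)))
    (mul_mem (by simp) (hK.mem_of_lt' (by omega) (by omega)))
    (mul_ne_zero two ha0) (mul_ne_zero two ha0')
    ((K s).smul_mem (truncForm_mem _ ham)) ((K s).smul_mem (truncForm_mem _ ham'))
    ((K s).smul_mem (truncForm_mem _ ham)) ((K s).smul_mem (truncForm_mem _ ham'))
    ((K s).smul_mem (truncForm_mem _ hbm)) ((K s).smul_mem (truncForm_mem _ hbm'))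
    ((K s).smul_mem (truncForm_mem _ hbm)) ((K s).smul_mem (truncForm_mem _ hbm'))
    ?_ (hcirc μ hμ0) (hcirc ν hν0)
  intro h0
  have hne := truncForm_ne_zero (B := B) hf (t := s) (p := 1) (k := k)
    (e := fun j => ∑ i, (![(c μ s 0)⁻¹, -(c ν s 0)⁻¹] : Fin 2 → ℝ) i *
      (![c μ s, c ν s] : Fin 2 → ℕ → ℝ) i j) le_rfl hk1 (by omega) (by omega) (by omega)
    (by simp [hsymm _ s k hks.le]) (by
      simp only [Fin.sum_univ_two, Matrix.cons_val]
      intro h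
      apply hk
      field_simp at h
      linear_combination h)
  rw [truncForm_sum] at hne
  apply hne
  simp only [Fin.sum_univ_two, Matrix.cons_val, neg_smul]
  rw [← sub_eq_add_neg, sub_eq_zero]
  exact h0

/-- The modulus of a form without leading term is the same for the generic point and for every
further solution of the measurement equations. For a combination of the three forms this is the
congruence of the two triangles of centres, `a t` being generic over everything else involved. -/
lemma LeadingTermFree.mul_eq (hf : Function.Injective f)
    (hsymm : ∀ μ s j, j ≤ s → c μ s (s - j) = c μ s j)
    {K : ℕ → IntermediateField ℝ L}
    (hK : GenericTower B (fun j => f (genSeq B j)) (fun j => f (genSeq' B j)) K)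
    {b b' : ℕ → L} (hb0 : b 0 = f (genSeq B 0) ∧ b' 0 = f (genSeq' B 0))
    (hbB : ∀ j, B ≤ j → b j = 0 ∧ b' j = 0)
    (hbK : ∀ s < B, b s ∈ K (s + 1) ∧ b' s ∈ K (s + 1)) {t : ℕ} (ht : 1 ≤ t) (htB : t ≤ B)
    (heq : ∀ μ, truncForm (c μ t) t 0 (fun j => f (genSeq B j)) *
      truncForm (c μ t) t 0 (fun j => f (genSeq' B j)) =
      truncForm (c μ t) t 0 b * truncForm (c μ t) t 0 b')
    {e : ℕ → ℝ} (he : LeadingTermFree B c t e) :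
    truncForm e t 1 (fun j => f (genSeq B j)) * truncForm e t 1 (fun j => f (genSeq' B j)) =
      truncForm e t 1 b * truncForm e t 1 b' := by
  set a := fun j => f (genSeq B j) with ha
  set a' := fun j => f (genSeq' B j) with ha'
  rcases he with ⟨κ, rfl, h0⟩ | ⟨htB', hthree, he0, l, rfl⟩
  · have h := heq κ
    have aB : ∀ j, B ≤ j → a j = 0 ∧ a' j = 0 := by
      intro j hj
      simp [ha, ha', genSeq, genSeq', not_lt.mpr hj]
    have key : ∀ z : ℕ → L, (∀ j, B ≤ j → z j = 0) →
        truncForm (c κ t) t 0 z = truncForm (c κ t) t 1 z := by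
      intro z hz
      rw [truncForm_eq_add (by omega) (hsymm κ t 0 (by omega))]
      rcases htB.lt_or_eq with h1 | h1
      · simp [h0 h1]
      · simp [hz t h1.ge]
    rwa [key a fun j hj => (aB j hj).1, key a' fun j hj => (aB j hj).2,
      key b fun j hj => (hbB j hj).1, key b' fun j hj => (hbB j hj).2] at h
  · have hgen : ∀ j < B, genSeq B j ≠ 0 ∧ genSeq' B j ≠ 0 := by
      intro j hj
      simp [genSeq, genSeq', hj, MvPolynomial.X_ne_zero]
    have ha0 : a 0 ≠ 0 := by
      rw [ha]; simp only [ne_eq, map_eq_zero_iff f hf]; exact (hgen 0 (by omega)).1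
    have ha0' : a' 0 ≠ 0 := by
      rw [ha']; simp only [ne_eq, map_eq_zero_iff f hf]; exact (hgen 0 (by omega)).2
    have two : (2 : L) ≠ 0 := by
      have : CharZero L := charZero_of_injective_algebraMap (algebraMap ℝ L).injective
      exact two_ne_zero
    have hbm : ∀ j, 1 ≤ j → j + 1 ≤ t → b j ∈ K t := fun j _ hj =>
      hK.mono (show j + 1 ≤ t from hj) (hbK j (by omega)).1
    have hbm' : ∀ j, 1 ≤ j → j + 1 ≤ t → b' j ∈ K t := fun j _ hj =>
      hK.mono (show j + 1 ≤ t from hj) (hbK j (by omega)).2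
    have ham : ∀ j, 1 ≤ j → j + 1 ≤ t → a j ∈ K t := fun j _ hj =>
      hK.mem_of_lt (by omega) (by omega)
    have ham' : ∀ j, 1 ≤ j → j + 1 ≤ t → a' j ∈ K t := fun j _ hj =>
      hK.mem_of_lt' (by omega) (by omega)
    have hdet := hthree.det_ne_zero hf htB' hsymm
    let r : K t := ⟨2 * a 0, mul_mem (by simp) (hK.mem_of_lt (by omega) (by omega))⟩
    let r' : K t := ⟨2 * a' 0, mul_mem (by simp) (hK.mem_of_lt' (by omega) (by omega))⟩
    have hr : r ≠ 0 := fun h => mul_ne_zero two ha0 (congrArg Subtype.val h)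
    have hr' : r' ≠ 0 := fun h => mul_ne_zero two ha0' (congrArg Subtype.val h)
    let α : Fin 3 → K t := fun μ => algebraMap ℝ (K t) (c μ t 0)
    let V : Fin 3 → K t := fun μ => ⟨truncForm (c μ t) t 1 a, truncForm_mem _ ham⟩
    let V' : Fin 3 → K t := fun μ => ⟨truncForm (c μ t) t 1 a', truncForm_mem _ ham'⟩
    let U : Fin 3 → K t := fun μ => ⟨truncForm (c μ t) t 1 b, truncForm_mem _ hbm⟩
    let U' : Fin 3 → K t := fun μ => ⟨truncForm (c μ t) t 1 b', truncForm_mem _ hbm'⟩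
    have hform : ∀ (κ : Fin 3) (z : ℕ → L), truncForm (c κ t) t 0 z =
        algebraMap ℝ L (c κ t 0) * (2 * z 0 * z t) + truncForm (c κ t) t 1 z := by
      intro κ z
      rw [truncForm_eq_add (by omega) (hsymm κ t 0 (by omega))]
      simp only [Algebra.smul_def, map_mul, map_ofNat, Nat.sub_zero, zero_add]
      ring
    have main := sum_mul_sum_eq_of_generic (K := K t)
      ((hK.indep t htB').mul hr hr') (α := α) (V := V) (V' := V') (U := U) (U' := U')
      (y := 2 * a 0 * b t) (y' := 2 * a' 0 * b' t)
      (fun μ h => hthree.1 μ (by simpa [α] using h)) ?_ ?_ (l := fun μ => algebraMap ℝ (K t) (l μ)) ?_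
    · have main' := congrArg Subtype.val main
      simp only [Fin.sum_univ_three] at main'
      rw [truncForm_sum, truncForm_sum, truncForm_sum, truncForm_sum]
      simp only [Fin.sum_univ_three, Algebra.smul_def]
      exact main'
    · intro h0
      apply hdet
      have h1 := congrArg (algebraMap (K t) L) h0
      simp only [Matrix.det_fin_three, Matrix.of_apply, Matrix.cons_val, map_sub, map_add, map_mul,
        map_zero] at h1
      simp only [Matrix.det_fin_three, Matrix.of_apply, formRow, Matrix.cons_val, zero_add,
        Algebra.smul_def, map_mul, map_ofNat]
      have hV : ∀ μ, algebraMap (K t) L (V μ) = truncForm (c μ t) t 1 a := fun μ => rfl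
      have hV' : ∀ μ, algebraMap (K t) L (V' μ) = truncForm (c μ t) t 1 a' := fun μ => rfl
      have hα : ∀ μ, algebraMap (K t) L (α μ) = algebraMap ℝ L (c μ t 0) := fun μ => rfl
      simp only [hV, hV', hα] at h1
      linear_combination (2 * a 0 ^ 2 * a' 0 ^ 2) * h1
    · intro μ
      have h := heq μ
      rw [hform, hform, hform, hform, hb0.1, hb0.2] at h
      exact h
    · have := congrArg (algebraMap ℝ (K t)) he0
      simpa only [map_sum, map_mul, map_zero] using this

/-- Over the generic point the measurement equations have no solution other than the generic point
itself, once the first three coefficients are fixed. -/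
theorem eq_genSeq_of_truncForm_mul_eq (hf : Function.Injective f)
    (hsymm : ∀ μ s j, j ≤ s → c μ s (s - j) = c μ s j)
    (htwo : ∀ s, 3 ≤ s → s < B → ∃ μ ν, TwoCircles c μ ν s)
    (hres : ∀ s, 3 ≤ s → s < B → Resolvable B c s)
    {b b' : ℕ → L} (hb : ∀ j < 3, b j = f (genSeq B j) ∧ b' j = f (genSeq' B j))
    (hbB : ∀ j, B ≤ j → b j = 0 ∧ b' j = 0)
    (heq : ∀ s, 3 ≤ s → s ≤ B → ∀ μ, truncForm (c μ s) s 0 (fun j => f (genSeq B j)) *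
      truncForm (c μ s) s 0 (fun j => f (genSeq' B j)) =
      truncForm (c μ s) s 0 b * truncForm (c μ s) s 0 b') :
    ∀ s, b s = f (genSeq B s) ∧ b' s = f (genSeq' B s) := by
  obtain ⟨K, hK⟩ := exists_genericTower (a := fun j => f (genSeq B j))
    (a' := fun j => f (genSeq' B j)) (algebraicIndependent_genSeq hf)
  have hbK := mem_tower_of_twoCircles hf hsymm hK hb htwo fun s h1 h2 => heq s h1 h2.le
  intro s
  induction s using Nat.strong_induction_on with
  | _ s ih =>
  by_cases h3 : s < 3
  · exact hb s h3
  by_cases hsB : B ≤ s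
  · rw [(hbB s hsB).1, (hbB s hsB).2]
    simp [genSeq, genSeq', not_lt.mpr hsB]
  push Not at h3 hsB
  rcases hres s h3 hsB with hthree | ⟨μ, ν, p, e, htc, hp, hps, hpB, hfree, hep, hej, hq⟩
  · exact eq_of_det_formRow_ne_zero (a := fun j => f (genSeq B j))
      (a' := fun j => f (genSeq' B j)) (e := fun μ => c μ s) (t := fun _ => s)
      (p := fun _ => 0) (fun _ => rfl) (fun _ => by omega) (fun _ => by omega)
      (fun μ j hj => hsymm μ s j hj) hthree.1 (hthree.det_ne_zero hf hsB hsymm) ih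
      (fun μ => heq s h3 hsB.le μ)
  · have hes : ∀ j, j ≤ s + p → e (s + p - j) = e j := by
      intro j hj
      rcases hfree with ⟨κ, rfl, -⟩ | ⟨-, -, -, l, rfl⟩
      · exact hsymm κ _ j hj
      · exact Finset.sum_congr rfl fun μ _ => by rw [hsymm μ _ j hj]
    have hthird := hfree.mul_eq hf hsymm hK (hb 0 (by omega)) hbB hbK (by omega) hpB
      (heq (s + p) (by omega) hpB)
    simp only [truncForm_one_eq hp (by omega) hes hej] at hthird
    refine eq_of_det_formRow_ne_zero (a := fun j => f (genSeq B j))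
      (a' := fun j => f (genSeq' B j)) (e := ![c μ s, c ν s, e])
      (t := ![s, s, s + p]) (p := ![0, 0, p]) ?_ ?_ ?_ ?_ ?_
      (htc.det_ne_zero hf hsymm hp hps hsB hes hep hq) ih ?_
    · intro i; fin_cases i <;> simp
    · intro i
      fin_cases i <;> simp <;> omega
    · intro i
      fin_cases i <;> simp <;> omega
    · intro i j hj
      fin_cases i
      · exact hsymm μ s j hj
      · exact hsymm ν s j hj
      · exact hes j hj
    · intro i
      fin_cases i
      · exact htc.1
      · exact htc.2.1
      · exact hep
    · intro i
      fin_cases i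
      · exact heq s h3 hsB.le μ
      · exact heq s h3 hsB.le ν
      · exact hthird

end GenericPoint

/-! ### From the generic point to generic complex points -/

/-- Generic specialization: if the equations `F` imply `g = 0` at every field-valued point whose
coordinates in `σ` are algebraically independent, then they do so at every point with coordinates
in `σ` off the zero locus of one nonzero polynomial. Otherwise a prime containing `F` would avoid
the powers of `g` and the nonzero polynomials in the variables of `σ`, and its residue field would
carry a forbidden point. -/
lemma exists_polynomial_of_generic {σ τ : Type} (F : Set (MvPolynomial (σ ⊕ τ) ℝ))
    (g : MvPolynomial (σ ⊕ τ) ℝ)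
    (h : ∀ (L : Type) [Field L] [Algebra ℝ L] (φ : MvPolynomial (σ ⊕ τ) ℝ →ₐ[ℝ] L),
      Function.Injective (φ.comp (MvPolynomial.rename Sum.inl)) → (∀ q ∈ F, φ q = 0) → φ g = 0) :
    ∃ P : MvPolynomial σ ℝ, P ≠ 0 ∧ ∀ ψ : MvPolynomial (σ ⊕ τ) ℝ →ₐ[ℝ] ℂ,
      (∀ q ∈ F, ψ q = 0) → ψ (MvPolynomial.rename Sum.inl P) ≠ 0 → ψ g = 0 := by
  let S : Submonoid (MvPolynomial (σ ⊕ τ) ℝ) :=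
    (nonZeroDivisors (MvPolynomial σ ℝ)).map (MvPolynomial.rename Sum.inl) ⊔ Submonoid.powers g
  by_cases hd : Disjoint (Ideal.span F : Set (MvPolynomial (σ ⊕ τ) ℝ)) S
  · exfalso
    obtain ⟨p, hp, hFp, hpS⟩ := Ideal.exists_le_prime_disjoint _ _ hd
    rw [Set.disjoint_left] at hpS
    let φ : MvPolynomial (σ ⊕ τ) ℝ →ₐ[ℝ] FractionRing (MvPolynomial (σ ⊕ τ) ℝ ⧸ p) :=
      (IsScalarTower.toAlgHom ℝ (MvPolynomial (σ ⊕ τ) ℝ ⧸ p) _).comp (Ideal.Quotient.mkₐ ℝ p)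
    have hφ : ∀ q, φ q = 0 ↔ q ∈ p := by
      intro q
      change algebraMap (MvPolynomial (σ ⊕ τ) ℝ ⧸ p) (FractionRing (MvPolynomial (σ ⊕ τ) ℝ ⧸ p))
        (Ideal.Quotient.mk p q) = 0 ↔ _
      rw [map_eq_zero_iff _ (IsFractionRing.injective _ _), Ideal.Quotient.eq_zero_iff_mem]
    refine hpS ((hφ g).mp (h _ φ ?_ fun q hq => (hφ q).mpr (hFp (Ideal.subset_span hq))))
      (Submonoid.mem_sup_right (Submonoid.mem_powers g))
    rw [injective_iff_map_eq_zero]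
    intro q hq
    by_contra hq0
    exact hpS ((hφ _).mp hq) (Submonoid.mem_sup_left
      ⟨q, mem_nonZeroDivisors_of_ne_zero hq0, rfl⟩)
  · rw [Set.not_disjoint_iff] at hd
    obtain ⟨q, hqF, hqS⟩ := hd
    obtain ⟨_, ⟨P, hP, rfl⟩, _, ⟨k, rfl⟩, rfl⟩ := Submonoid.mem_sup.mp hqS
    refine ⟨P, nonZeroDivisors.ne_zero hP, fun ψ hψ hψP => ?_⟩
    have hle : Ideal.span F ≤ RingHom.ker ψ := Ideal.span_le.mpr fun q hq => hψ q hq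
    have h0 : ψ (MvPolynomial.rename Sum.inl P * g ^ k) = 0 := hle hqF
    rw [map_mul, map_pow] at h0
    exact eq_zero_of_pow_eq_zero ((mul_eq_zero.mp h0).resolve_left hψP)

/-- Real and imaginary parts of a polynomial in `z` and `conj z`. -/
lemma exists_re_im_polynomial {σ : Type} (P : MvPolynomial (σ ⊕ σ) ℝ) :
    ∃ R S : MvPolynomial (σ ⊕ σ) ℝ, ∀ z : σ → ℂ,
      MvPolynomial.aeval (Sum.elim z fun j => (starRingEnd ℂ) (z j)) P =
        (MvPolynomial.eval (Sum.elim (fun j => (z j).re) fun j => (z j).im) R : ℂ) +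
        (MvPolynomial.eval (Sum.elim (fun j => (z j).re) fun j => (z j).im) S : ℂ) * Complex.I := by
  induction P using MvPolynomial.induction_on with
  | C r => exact ⟨MvPolynomial.C r, 0, fun z => by simp⟩
  | add p q hp hq =>
    obtain ⟨R, S, h⟩ := hp
    obtain ⟨R', S', h'⟩ := hq
    refine ⟨R + R', S + S', fun z => ?_⟩
    rw [map_add, h, h']
    simp only [map_add, Complex.ofReal_add]
    ring
  | mul_X p i hp =>
    obtain ⟨R, S, h⟩ := hp
    have hI : Complex.I * Complex.I = -1 := Complex.I_mul_I
    rcases i with j | j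
    · refine ⟨R * MvPolynomial.X (Sum.inl j) - S * MvPolynomial.X (Sum.inr j),
        R * MvPolynomial.X (Sum.inr j) + S * MvPolynomial.X (Sum.inl j), fun z => ?_⟩
      have hz := Complex.re_add_im (z j)
      rw [map_mul, h]
      simp only [map_add, map_sub, map_mul, MvPolynomial.aeval_X, MvPolynomial.eval_X,
        Sum.elim_inl, Sum.elim_inr, Complex.ofReal_add, Complex.ofReal_sub, Complex.ofReal_mul]
      conv_lhs => rw [← hz]
      linear_combination (MvPolynomial.eval (Sum.elim (fun j => (z j).re) fun j => (z j).im) S : ℂ) *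
        ((z j).im : ℂ) * hI
    · refine ⟨R * MvPolynomial.X (Sum.inl j) + S * MvPolynomial.X (Sum.inr j),
        S * MvPolynomial.X (Sum.inl j) - R * MvPolynomial.X (Sum.inr j), fun z => ?_⟩
      have hz : (starRingEnd ℂ) (z j) = (z j).re - (z j).im * Complex.I := by
        apply Complex.ext <;> simp
      rw [map_mul, h]
      simp only [map_add, map_sub, map_mul, MvPolynomial.aeval_X, MvPolynomial.eval_X,
        Sum.elim_inl, Sum.elim_inr, Complex.ofReal_add, Complex.ofReal_sub, Complex.ofReal_mul, hz]
      linear_combination -(MvPolynomial.eval (Sum.elim (fun j => (z j).re) fun j => (z j).im) S : ℂ) *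
        ((z j).im : ℂ) * hI

/-- The points `(z, conj z)` are Zariski dense. -/
lemma exists_aeval_conj_ne_zero {σ : Type} {P : MvPolynomial (σ ⊕ σ) ℝ} (hP : P ≠ 0) :
    ∃ z : σ → ℂ, MvPolynomial.aeval (Sum.elim z fun j => (starRingEnd ℂ) (z j)) P ≠ 0 := by
  by_contra hcon
  push Not at hcon
  set T : MvPolynomial (σ ⊕ σ) ℂ := MvPolynomial.aeval (Sum.elim
    (fun j => MvPolynomial.X (Sum.inl j) + MvPolynomial.C Complex.I * MvPolynomial.X (Sum.inr j))
    (fun j => MvPolynomial.X (Sum.inl j) - MvPolynomial.C Complex.I * MvPolynomial.X (Sum.inr j))) P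
    with hT
  have hev : ∀ w : σ ⊕ σ → ℂ, MvPolynomial.eval w T = MvPolynomial.aeval (Sum.elim
      (fun j => w (Sum.inl j) + Complex.I * w (Sum.inr j))
      (fun j => w (Sum.inl j) - Complex.I * w (Sum.inr j))) P := by
    intro w
    have : MvPolynomial.eval w T = ((MvPolynomial.aeval w : MvPolynomial (σ ⊕ σ) ℂ →ₐ[ℂ] ℂ).restrictScalars ℝ) T := by
      simp [MvPolynomial.aeval_eq_eval]
    rw [this, hT, ← AlgHom.comp_apply]
    congr 1
    ext i
    rcases i with i | i <;> simp
  have hT0 : T = 0 := by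
    refine MvPolynomial.funext_set (fun _ => Set.range (fun r : ℝ => (r : ℂ)))
      (fun _ => Set.infinite_range_of_injective Complex.ofReal_injective) fun w hw => ?_
    choose r hr using fun i => hw i (Set.mem_univ i)
    rw [hev, map_zero, ← hcon fun j => (r (Sum.inl j) : ℂ) + Complex.I * r (Sum.inr j)]
    congr 2
    funext i
    rcases i with i | i
    · simp [← hr]
    · simp [← hr, sub_eq_add_neg]
  apply hP
  apply MvPolynomial.map_injective (algebraMap ℝ ℂ) (algebraMap ℝ ℂ).injective
  rw [map_zero]
  apply MvPolynomial.funext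
  intro w
  have h1 := hev (Sum.elim (fun j => (w (Sum.inl j) + w (Sum.inr j)) / 2)
    (fun j => (w (Sum.inl j) - w (Sum.inr j)) / (2 * Complex.I)))
  rw [hT0, map_zero] at h1
  rw [map_zero, MvPolynomial.eval_map, ← MvPolynomial.aeval_def, h1]
  congr 2
  funext i
  have hI : Complex.I ≠ 0 := Complex.I_ne_zero
  rcases i with i | i <;> simp <;> field_simp <;> ring

/-- A nonzero polynomial condition in `z` and `conj z` contains a nonzero polynomial condition in
the real and imaginary parts. -/
lemma exists_real_polynomial {σ : Type} {P : MvPolynomial (σ ⊕ σ) ℝ} (hP : P ≠ 0) :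
    ∃ Q : MvPolynomial (σ ⊕ σ) ℝ, Q ≠ 0 ∧ ∀ z : σ → ℂ,
      MvPolynomial.eval (Sum.elim (fun j => (z j).re) fun j => (z j).im) Q ≠ 0 →
      MvPolynomial.aeval (Sum.elim z fun j => (starRingEnd ℂ) (z j)) P ≠ 0 := by
  obtain ⟨R, S, h⟩ := exists_re_im_polynomial P
  have key : ∀ z : σ → ℂ,
      MvPolynomial.eval (Sum.elim (fun j => (z j).re) fun j => (z j).im) (R ^ 2 + S ^ 2) ≠ 0 ↔
      MvPolynomial.aeval (Sum.elim z fun j => (starRingEnd ℂ) (z j)) P ≠ 0 := by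
    intro z
    rw [h z, ne_eq, ne_eq, ← Complex.normSq_eq_zero, Complex.normSq_add_mul_I]
    simp
  obtain ⟨z, hz⟩ := exists_aeval_conj_ne_zero hP
  refine ⟨R ^ 2 + S ^ 2, fun h0 => ?_, fun z => (key z).mp⟩
  have := (key z).mpr hz
  rw [h0, map_zero] at this
  exact this rfl

lemma truncForm_conj (c : ℕ → ℝ) (t p : ℕ) (a : ℕ → ℂ) :
    truncForm c t p (fun j => (starRingEnd ℂ) (a j)) = (starRingEnd ℂ) (truncForm c t p a) :=
  (map_truncForm (Complex.conjAe : ℂ →ₐ[ℝ] ℂ) c t p a).symm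

lemma truncForm_mul_truncForm_conj (c : ℕ → ℝ) (t p : ℕ) (a : ℕ → ℂ) :
    truncForm c t p a * truncForm c t p (fun j => (starRingEnd ℂ) (a j)) =
      ((‖truncForm c t p a‖ ^ 2 : ℝ) : ℂ) := by
  rw [truncForm_conj, Complex.mul_conj, Complex.normSq_eq_norm_sq]

/-- A generic sequence is determined by its first three terms and the moduli of the forms. -/
theorem exists_polynomial_determined {B : ℕ} {c : Fin 3 → ℕ → ℕ → ℝ}
    (hsymm : ∀ μ s j, j ≤ s → c μ s (s - j) = c μ s j)
    (htwo : ∀ s, 3 ≤ s → s < B → ∃ μ ν, TwoCircles c μ ν s)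
    (hres : ∀ s, 3 ≤ s → s < B → Resolvable B c s) :
    ∃ P : MvPolynomial (Fin B ⊕ Fin B) ℝ, P ≠ 0 ∧ ∀ a b : ℕ → ℂ,
      (∀ j, B ≤ j → a j = 0 ∧ b j = 0) → (∀ j < 3, b j = a j) →
      (∀ s, 3 ≤ s → s ≤ B → ∀ μ, ‖truncForm (c μ s) s 0 b‖ = ‖truncForm (c μ s) s 0 a‖) →
      MvPolynomial.aeval (Sum.elim (fun j : Fin B => a j)
        (fun j : Fin B => (starRingEnd ℂ) (a j))) P ≠ 0 → b = a := by
  let σ := Fin B ⊕ Fin B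
  let A := MvPolynomial (σ ⊕ σ) ℝ
  let il : MvPolynomial σ ℝ →ₐ[ℝ] A := MvPolynomial.rename Sum.inl
  let ir : MvPolynomial σ ℝ →ₐ[ℝ] A := MvPolynomial.rename Sum.inr
  let F : Set A := {q | (∃ j < 3, q = ir (genSeq B j) - il (genSeq B j) ∨
      q = ir (genSeq' B j) - il (genSeq' B j)) ∨
    ∃ s, 3 ≤ s ∧ s ≤ B ∧ ∃ μ, q = il (truncForm (c μ s) s 0 (genSeq B)) *
      il (truncForm (c μ s) s 0 (genSeq' B)) - ir (truncForm (c μ s) s 0 (genSeq B)) *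
      ir (truncForm (c μ s) s 0 (genSeq' B))}
  have hex : ∀ i : Fin B, ∃ P : MvPolynomial σ ℝ, P ≠ 0 ∧ ∀ ψ : A →ₐ[ℝ] ℂ,
      (∀ q ∈ F, ψ q = 0) → ψ (il P) ≠ 0 → ψ (ir (genSeq B i) - il (genSeq B i)) = 0 := by
    intro i
    apply exists_polynomial_of_generic F
    intro L _ _ φ hφ hF
    have := eq_genSeq_of_truncForm_mul_eq (B := B) (f := φ.comp il) hφ hsymm htwo hres
      (b := fun j => φ (ir (genSeq B j))) (b' := fun j => φ (ir (genSeq' B j))) ?_ ?_ ?_ i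
    · rw [map_sub, sub_eq_zero]
      exact this.1
    · intro j hj
      have h1 := hF _ (Or.inl ⟨j, hj, Or.inl rfl⟩)
      have h2 := hF _ (Or.inl ⟨j, hj, Or.inr rfl⟩)
      rw [map_sub, sub_eq_zero] at h1 h2
      exact ⟨h1, h2⟩
    · intro j hj
      simp [genSeq, genSeq', not_lt.mpr hj]
    · intro s h3 hsB μ
      have h1 := hF _ (Or.inr ⟨s, h3, hsB, μ, rfl⟩)
      rw [map_sub, sub_eq_zero, map_mul, map_mul] at h1
      simpa only [map_truncForm, AlgHom.comp_apply] using h1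
  choose P hP0 hP using hex
  refine ⟨∏ i, P i, Finset.prod_ne_zero_iff.mpr fun i _ => hP0 i, ?_⟩
  intro a b hB h3 hnorm hne
  rw [map_prod, Finset.prod_ne_zero_iff] at hne
  funext j
  by_cases hj : j < B
  swap
  · rw [(hB j (not_lt.mp hj)).1, (hB j (not_lt.mp hj)).2]
  let za : σ → ℂ := Sum.elim (fun j : Fin B => a j) (fun j : Fin B => (starRingEnd ℂ) (a j))
  let zb : σ → ℂ := Sum.elim (fun j : Fin B => b j) (fun j : Fin B => (starRingEnd ℂ) (b j))
  let ψ : A →ₐ[ℝ] ℂ := MvPolynomial.aeval (Sum.elim za zb)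
  have hψl : ∀ q, ψ (il q) = MvPolynomial.aeval za q := by
    exact fun q => MvPolynomial.aeval_rename Sum.inl (Sum.elim za zb) q
  have hψr : ∀ q, ψ (ir q) = MvPolynomial.aeval zb q := by
    exact fun q => MvPolynomial.aeval_rename Sum.inr (Sum.elim za zb) q
  have hg : ∀ (z : ℕ → ℂ), (∀ j, B ≤ j → z j = 0) → ∀ j,
      MvPolynomial.aeval (Sum.elim (fun j : Fin B => z j)
        (fun j : Fin B => (starRingEnd ℂ) (z j))) (genSeq B j) = z j ∧
      MvPolynomial.aeval (Sum.elim (fun j : Fin B => z j)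
        (fun j : Fin B => (starRingEnd ℂ) (z j))) (genSeq' B j) = (starRingEnd ℂ) (z j) := by
    intro z hz j
    unfold genSeq genSeq'
    split_ifs with h
    · simp
    · simp [hz j (by omega)]
  have hga := hg a fun j hj => (hB j hj).1
  have hgb := hg b fun j hj => (hB j hj).2
  have main := hP ⟨j, hj⟩ ψ ?_ (by rw [hψl]; exact hne _ (Finset.mem_univ _))
  · rw [map_sub, sub_eq_zero, hψl, hψr] at main
    rw [← (hgb j).1, ← (hga j).1]
    exact main
  · rintro q (⟨i, hi, rfl | rfl⟩ | ⟨s, hs3, hsB, μ, rfl⟩)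
    · rw [map_sub, sub_eq_zero, hψl, hψr, (hga i).1, (hgb i).1, h3 i hi]
    · rw [map_sub, sub_eq_zero, hψl, hψr, (hga i).2, (hgb i).2, h3 i hi]
    · rw [map_sub, sub_eq_zero, map_mul, map_mul, hψl, hψl, hψr, hψr, map_truncForm, map_truncForm,
        map_truncForm, map_truncForm]
      simp only [za, zb, (hga _).1, (hga _).2, (hgb _).1, (hgb _).2]
      rw [truncForm_mul_truncForm_conj, truncForm_mul_truncForm_conj, hnorm s hs3 hsB μ]

/-! ### Normalization by the trivial ambiguities -/

lemma exists_norm_one_mul_eq {x y : ℂ} (h : ‖x‖ = ‖y‖) : ∃ u : ℂ, ‖u‖ = 1 ∧ u * x = y := by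
  by_cases hx : x = 0
  · refine ⟨1, norm_one, ?_⟩
    rw [hx, norm_zero] at h
    rw [hx, mul_zero, norm_eq_zero.mp h.symm]
  · exact ⟨y / x, by rw [norm_div, ← h, div_self (norm_ne_zero_iff.mpr hx)], div_mul_cancel₀ _ hx⟩

lemma conj_mul_self_of_norm_one {u : ℂ} (h : ‖u‖ = 1) : (starRingEnd ℂ) u * u = 1 := by
  rw [mul_comm, Complex.mul_conj, Complex.normSq_eq_norm_sq, h]; simp

lemma truncForm_geometric (c : ℕ → ℝ) (t : ℕ) (u v : ℂ) (a : ℕ → ℂ) :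
    truncForm c t 0 (fun j => u * v ^ j * a j) = u ^ 2 * v ^ t * truncForm c t 0 a := by
  unfold truncForm
  rw [Finset.mul_sum]
  refine Finset.sum_congr rfl fun j hj => ?_
  rw [Finset.mem_Ico] at hj
  rw [show v ^ t = v ^ j * v ^ (t - j) by rw [← pow_add]; congr 1; omega]
  simp only [Complex.real_smul]
  ring

lemma norm_truncForm_geometric (c : ℕ → ℝ) (t : ℕ) {u v : ℂ} (hu : ‖u‖ = 1) (hv : ‖v‖ = 1)
    (a : ℕ → ℂ) : ‖truncForm c t 0 (fun j => u * v ^ j * a j)‖ = ‖truncForm c t 0 a‖ := by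
  rw [truncForm_geometric, norm_mul, norm_mul, norm_pow, norm_pow, hu, hv]
  simp

lemma norm_truncForm_conj (c : ℕ → ℝ) (t : ℕ) (a : ℕ → ℂ) :
    ‖truncForm c t 0 (fun j => (starRingEnd ℂ) (a j))‖ = ‖truncForm c t 0 a‖ := by
  rw [truncForm_conj, Complex.norm_conj]

/-- The distances from two real multiples of `q` determine a point up to reflection in the line
`ℝ q`. -/
lemma eq_or_eq_conj_of_two_circles {p p' q : ℂ} {α β γ δ : ℝ} (hα : α ≠ 0) (hγ : γ ≠ 0)
    (hne : β * γ ≠ δ * α) (h1 : ‖α * p + β * q‖ = ‖α * p' + β * q‖)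
    (h2 : ‖γ * p + δ * q‖ = ‖γ * p' + δ * q‖) :
    p * (starRingEnd ℂ) q = p' * (starRingEnd ℂ) q ∨
      p * (starRingEnd ℂ) q = (starRingEnd ℂ) p' * q := by
  have expand : ∀ (a b : ℝ) (z : ℂ), ‖(a : ℂ) * z + b * q‖ ^ 2 =
      a ^ 2 * (z.re ^ 2 + z.im ^ 2) + 2 * a * b * (z.re * q.re + z.im * q.im) +
        b ^ 2 * (q.re ^ 2 + q.im ^ 2) := by
    intro a b z
    rw [← Complex.normSq_eq_norm_sq, Complex.normSq_apply]
    simp only [Complex.add_re, Complex.add_im, Complex.mul_re, Complex.mul_im, Complex.ofReal_re,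
      Complex.ofReal_im]
    ring
  have e1 := congrArg (· ^ 2) h1
  have e2 := congrArg (· ^ 2) h2
  simp only [expand] at e1 e2
  have f1 : α * (p.re ^ 2 + p.im ^ 2 - p'.re ^ 2 - p'.im ^ 2) +
      2 * β * (p.re * q.re + p.im * q.im - p'.re * q.re - p'.im * q.im) = 0 := by
    apply mul_left_cancel₀ hα
    linear_combination e1
  have f2 : γ * (p.re ^ 2 + p.im ^ 2 - p'.re ^ 2 - p'.im ^ 2) +
      2 * δ * (p.re * q.re + p.im * q.im - p'.re * q.re - p'.im * q.im) = 0 := by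
    apply mul_left_cancel₀ hγ
    linear_combination e2
  have hre : p.re * q.re + p.im * q.im - p'.re * q.re - p'.im * q.im = 0 := by
    apply mul_left_cancel₀ (sub_ne_zero.mpr hne)
    linear_combination γ / 2 * f1 - α / 2 * f2
  have hsq : p.re ^ 2 + p.im ^ 2 - p'.re ^ 2 - p'.im ^ 2 = 0 := by
    apply mul_left_cancel₀ hα
    linear_combination f1 - 2 * β * hre
  have him : (p.im * q.re - p.re * q.im) ^ 2 = (p'.im * q.re - p'.re * q.im) ^ 2 := by
    linear_combination (q.re ^ 2 + q.im ^ 2) * hsq -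
      (p.re * q.re + p.im * q.im + p'.re * q.re + p'.im * q.im) * hre
  rcases sq_eq_sq_iff_eq_or_eq_neg.mp him with h | h
  · left
    apply Complex.ext
    · simp; linear_combination hre
    · simp; linear_combination h
  · right
    apply Complex.ext
    · simp; linear_combination hre
    · simp; linear_combination h

/-- A generic sequence is determined by the moduli of its first two terms and of the forms, up to
multiplication by a geometric progression on the unit circle and conjugation. -/
theorem exists_polynomial_determined_up_to {B : ℕ} {c : Fin 3 → ℕ → ℕ → ℝ}
    (hsymm : ∀ μ s j, j ≤ s → c μ s (s - j) = c μ s j)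
    (htwo : ∀ s, 2 ≤ s → s < B → ∃ μ ν, TwoCircles c μ ν s)
    (hres : ∀ s, 3 ≤ s → s < B → Resolvable B c s) :
    ∃ Q : MvPolynomial (Fin B ⊕ Fin B) ℝ, Q ≠ 0 ∧ ∀ a b : ℕ → ℂ,
      (∀ j, B ≤ j → a j = 0 ∧ b j = 0) →
      MvPolynomial.eval (Sum.elim (fun j : Fin B => (a j).re) (fun j : Fin B => (a j).im)) Q ≠ 0 →
      (∀ s < 2, ‖b s‖ = ‖a s‖) →
      (∀ s, 2 ≤ s → s ≤ B → ∀ μ, ‖truncForm (c μ s) s 0 b‖ = ‖truncForm (c μ s) s 0 a‖) →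
      ∃ u v : ℂ, ‖u‖ = 1 ∧ ‖v‖ = 1 ∧ ((∀ j, b j = u * v ^ j * a j) ∨
        ∀ j, b j = u * v ^ j * (starRingEnd ℂ) (a j)) := by
  obtain ⟨P, hP0, hP⟩ := exists_polynomial_determined hsymm
    (fun s hs => htwo s (by omega)) hres
  have hnz : ∀ j, ∃ R : MvPolynomial (Fin B ⊕ Fin B) ℝ, R ≠ 0 ∧ (j < B → R = genSeq B j) := by
    intro j
    by_cases h : j < B
    · exact ⟨genSeq B j, by simp [genSeq, h, MvPolynomial.X_ne_zero], fun _ => rfl⟩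
    · exact ⟨1, one_ne_zero, fun h' => absurd h' h⟩
  obtain ⟨R0, hR0, hR0'⟩ := hnz 0
  obtain ⟨R1, hR1, hR1'⟩ := hnz 1
  obtain ⟨Q, hQ0, hQ⟩ := exists_real_polynomial (mul_ne_zero hP0 (mul_ne_zero hR0 hR1))
  refine ⟨Q, hQ0, ?_⟩
  intro a b hB hQa h2 hnorm
  have hne := hQ (fun j : Fin B => a j) hQa
  rw [map_mul, map_mul] at hne
  have hPa := left_ne_zero_of_mul hne
  have ha0 : 0 < B → a 0 ≠ 0 := by
    intro h
    have := left_ne_zero_of_mul (right_ne_zero_of_mul hne)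
    rw [hR0' h] at this
    simpa [genSeq, h] using this
  have ha1 : 1 < B → a 1 ≠ 0 := by
    intro h
    have := right_ne_zero_of_mul (right_ne_zero_of_mul hne)
    rw [hR1' h] at this
    simpa [genSeq, h] using this
  -- normalize `b` so that its first two terms agree with those of `a`
  obtain ⟨u, hu, hub⟩ := exists_norm_one_mul_eq (h2 0 (by omega))
  obtain ⟨w, hw, hwb⟩ := exists_norm_one_mul_eq (h2 1 (by omega))
  obtain ⟨u₀, hu₀, hua⟩ := exists_norm_one_mul_eq (Complex.norm_conj (a 0))
  obtain ⟨w₀, hw₀, hwa⟩ := exists_norm_one_mul_eq (Complex.norm_conj (a 1))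
  have hu0 : u ≠ 0 := norm_ne_zero_iff.mp (by rw [hu]; exact one_ne_zero)
  have hw0 : w ≠ 0 := norm_ne_zero_iff.mp (by rw [hw]; exact one_ne_zero)
  have hu₀0 : u₀ ≠ 0 := norm_ne_zero_iff.mp (by rw [hu₀]; exact one_ne_zero)
  set v := w / u with hv
  set v₀ := w₀ / u₀ with hv₀
  have hvn : ‖v‖ = 1 := by rw [hv, norm_div, hu, hw, div_one]
  have hvn₀ : ‖v₀‖ = 1 := by rw [hv₀, norm_div, hu₀, hw₀, div_one]
  have hv0 : v ≠ 0 := norm_ne_zero_iff.mp (by rw [hvn]; exact one_ne_zero)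
  set b₁ : ℕ → ℂ := fun j => u * v ^ j * b j with hb₁
  have hb₁0 : b₁ 0 = a 0 := by simp only [hb₁, pow_zero, mul_one]; exact hub
  have hb₁1 : b₁ 1 = a 1 := by
    simp only [hb₁, pow_one, hv, mul_div_cancel₀ _ hu0]; exact hwb
  have hb₁B : ∀ j, B ≤ j → b₁ j = 0 := fun j hj => by simp [hb₁, (hB j hj).2]
  have hb₁n : ∀ s, 2 ≤ s → s ≤ B → ∀ μ,
      ‖truncForm (c μ s) s 0 b₁‖ = ‖truncForm (c μ s) s 0 a‖ := fun s h h' μ => by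
    rw [hb₁, norm_truncForm_geometric _ _ hu hvn, hnorm s h h' μ]
  have hcase : b₁ 2 = a 2 ∨ b₁ 2 = u₀ * v₀ ^ 2 * (starRingEnd ℂ) (a 2) := by
    by_cases hB2 : 2 < B
    swap
    · left
      rw [hb₁B 2 (by omega), (hB 2 (by omega)).1]
    obtain ⟨μ, ν, hμ, hν, k, hk1, hk2, hk⟩ := htwo 2 le_rfl hB2
    obtain rfl : k = 1 := by omega
    have hform : ∀ (κ : Fin 3) (z : ℕ → ℂ), truncForm (c κ 2) 2 0 z =
        ((2 * c κ 2 0 : ℝ) : ℂ) * (z 0 * z 2) + ((c κ 2 1 : ℝ) : ℂ) * (z 1 * z 1) := by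
      intro κ z
      rw [truncForm_eq_add (by omega) (hsymm κ 2 0 (by omega))]
      simp [truncForm, Complex.real_smul]
    have e1 := hb₁n 2 le_rfl hB2.le μ
    have e2 := hb₁n 2 le_rfl hB2.le ν
    rw [hform, hform, hb₁0, hb₁1] at e1 e2
    have ha0' := ha0 (by omega)
    have ha1' := ha1 (by omega)
    have hca0 : (starRingEnd ℂ) (a 0) ≠ 0 := by simpa using ha0'
    have hca1 : (starRingEnd ℂ) (a 1) ≠ 0 := by simpa using ha1'
    rcases eq_or_eq_conj_of_two_circles (mul_ne_zero two_ne_zero hμ) (mul_ne_zero two_ne_zero hν)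
      (fun h => hk (by linear_combination h / 2)) e1 e2 with h | h
    · left
      rw [map_mul] at h
      exact mul_left_cancel₀ ha0' (mul_right_cancel₀ (mul_ne_zero hca1 hca1) h)
    · right
      have hu₀' : u₀ = a 0 / (starRingEnd ℂ) (a 0) := by rw [eq_div_iff hca0, hua]
      have hw₀' : w₀ = a 1 / (starRingEnd ℂ) (a 1) := by rw [eq_div_iff hca1, hwa]
      simp only [map_mul] at h
      rw [hv₀, hu₀', hw₀']
      field_simp
      linear_combination h
  rcases hcase with h | h
  · have key := hP a b₁ (fun j hj => ⟨(hB j hj).1, hb₁B j hj⟩) (by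
      intro j hj
      interval_cases j
      exacts [hb₁0, hb₁1, h]) (fun s h3 => hb₁n s (by omega)) hPa
    refine ⟨u⁻¹, v⁻¹, by rw [norm_inv, hu, inv_one], by rw [norm_inv, hvn, inv_one], Or.inl ?_⟩
    intro j
    rw [← key, hb₁, inv_pow]
    field_simp
  · set b₂ : ℕ → ℂ := fun j => u₀ * v₀ ^ j * (starRingEnd ℂ) (b₁ j) with hb₂
    have cu := conj_mul_self_of_norm_one hu₀
    have cv := conj_mul_self_of_norm_one hvn₀
    have key := hP a b₂ (fun j hj => ⟨(hB j hj).1, by simp [hb₂, hb₁B j hj]⟩) (by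
      intro j hj
      interval_cases j
      · simp only [hb₂, hb₁0, pow_zero, mul_one]; exact hua
      · simp only [hb₂, hb₁1, pow_one, hv₀, mul_div_cancel₀ _ hu₀0]; exact hwa
      · simp only [hb₂, h, map_mul, map_pow, Complex.conj_conj]
        linear_combination (a 2 * (((starRingEnd ℂ) v₀ * v₀) ^ 2)) * cu +
          a 2 * ((starRingEnd ℂ) v₀ * v₀ + 1) * cv) (fun s h3 h' μ => by
        rw [hb₂, norm_truncForm_geometric _ _ hu₀ hvn₀, norm_truncForm_conj,
          hb₁n s (by omega) h' μ]) hPa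
    refine ⟨u₀ * u⁻¹, v₀ * v⁻¹, by rw [norm_mul, norm_inv, hu, hu₀]; simp,
      by rw [norm_mul, norm_inv, hvn, hvn₀]; simp, Or.inr ?_⟩
    intro j
    have cvj : (starRingEnd ℂ) v₀ ^ j * v₀ ^ j = 1 := by rw [← mul_pow, cv, one_pow]
    have e : u₀ * v₀ ^ j * (starRingEnd ℂ) (a j) = b₁ j := by
      rw [← key, hb₂]
      simp only [map_mul, map_pow, Complex.conj_conj]
      linear_combination b₁ j * ((starRingEnd ℂ) v₀ ^ j * v₀ ^ j) * cu + b₁ j * cvj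
    have e2 : u₀ * u⁻¹ * (v₀ * v⁻¹) ^ j * (starRingEnd ℂ) (a j) =
        u⁻¹ * (v⁻¹) ^ j * (u₀ * v₀ ^ j * (starRingEnd ℂ) (a j)) := by
      rw [mul_pow]; ring
    rw [e2, e, hb₁, inv_pow]
    field_simp

/-! ### The FROG trace in terms of the Fourier coefficients -/

/-- The coefficients of the `m`-th form of degree `s`, for `r = N / L`. -/
noncomputable def cosCoeff (r m s j : ℕ) : ℝ :=
  Real.cos (Real.pi * m * ((s : ℝ) - 2 * j) / r)

lemma cosCoeff_symm (r m : ℕ) {s j : ℕ} (h : j ≤ s) : cosCoeff r m s (s - j) = cosCoeff r m s j := by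
  unfold cosCoeff
  rw [← Real.cos_neg, Nat.cast_sub h]
  congr 1
  ring

/-- The Fourier coefficients in the band that starts at `i`, extended by zero. -/
noncomputable def bandSeq {N : ℕ} [NeZero N] (B : ℕ) (i : ZMod N) (x : ZMod N → ℂ) (j : ℕ) : ℂ :=
  if j < B then ZMod.dft x (i + (j : ZMod N)) else 0

section Signals

variable {N : ℕ} [NeZero N]

lemma sum_eq_sum_range_add (i : ZMod N) (f : ZMod N → ℂ) :
    ∑ l, f l = ∑ j ∈ Finset.range N, f (i + (j : ZMod N)) := by
  symm
  refine Finset.sum_nbij' (fun j => i + (j : ZMod N)) (fun l => (l - i).val) ?_ ?_ ?_ ?_ ?_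
  · intro j _; exact Finset.mem_univ _
  · intro l _; exact Finset.mem_range.mpr (ZMod.val_lt _)
  · intro j hj
    rw [Finset.mem_range] at hj
    simp only [add_sub_cancel_left]
    exact ZMod.val_cast_of_lt hj
  · intro l _
    simp
  · intro j _; rfl

lemma bandSeq_eq_dft {B : ℕ} {i : ZMod N} {x : ZMod N → ℂ} (hx : IsBandlimitedAt B i x) {j : ℕ}
    (hj : j < N) : bandSeq B i x j = ZMod.dft x (i + (j : ZMod N)) := by
  unfold bandSeq
  split_ifs with h
  · rfl
  · exact (hx j (not_lt.mp h) hj).symm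

lemma bandSeq_eq_zero {B : ℕ} {i : ZMod N} {x : ZMod N → ℂ} {j : ℕ} (hj : B ≤ j) :
    bandSeq B i x j = 0 := if_neg (not_lt.mpr hj)

lemma dft_mul_shift (x : ZMod N → ℂ) (d k : ZMod N) :
    ZMod.dft (fun n => x n * x (n + d)) k =
      (N : ℂ)⁻¹ * ∑ l, ZMod.stdAddChar (l * d) * (ZMod.dft x l * ZMod.dft x (k - l)) := by
  have hinv : ∀ n, x n = (N : ℂ)⁻¹ * ∑ l, ZMod.stdAddChar (l * n) * ZMod.dft x l := by
    intro n
    conv_lhs => rw [← ZMod.dft.symm_apply_apply x, ZMod.invDFT_apply]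
    simp only [smul_eq_mul]
  rw [ZMod.dft_apply]
  calc ∑ n, ZMod.stdAddChar (-(n * k)) • (x n * x (n + d))
      = ∑ n, ∑ l, (N : ℂ)⁻¹ * (ZMod.stdAddChar (l * d) * (ZMod.dft x l *
          (ZMod.stdAddChar (-(n * (k - l))) * x n))) := by
        refine Finset.sum_congr rfl fun n _ => ?_
        rw [hinv (n + d), smul_eq_mul, Finset.mul_sum, Finset.mul_sum, Finset.mul_sum]
        refine Finset.sum_congr rfl fun l _ => ?_
        rw [show -(n * (k - l)) = -(n * k) + l * n by ring, mul_add, AddChar.map_add_eq_mul,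
          AddChar.map_add_eq_mul]
        ring
    _ = _ := by
        rw [Finset.sum_comm, Finset.mul_sum]
        refine Finset.sum_congr rfl fun l _ => ?_
        rw [ZMod.dft_apply x (k - l), Finset.mul_sum, Finset.mul_sum, Finset.mul_sum]
        simp only [smul_eq_mul]

/-- Symmetrization of `∑ a j * a (s - j) * η ^ (2 j)` under `j ↔ s - j`. -/
lemma sum_exp_eq_truncForm (r m s : ℕ) (a : ℕ → ℂ) :
    ∑ j ∈ Finset.range (s + 1), Complex.exp (Real.pi * m / r * (2 * j) * Complex.I) *
      (a j * a (s - j)) =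
      Complex.exp (Real.pi * m / r * s * Complex.I) * truncForm (cosCoeff r m s) s 0 a := by
  set S := ∑ j ∈ Finset.range (s + 1), Complex.exp (Real.pi * m / r * (2 * j) * Complex.I) *
      (a j * a (s - j)) with hS
  have hrefl : S = ∑ j ∈ Finset.range (s + 1),
      Complex.exp (Real.pi * m / r * (2 * (s - j)) * Complex.I) * (a j * a (s - j)) := by
    rw [hS, ← Finset.sum_range_reflect]
    refine Finset.sum_congr rfl fun j hj => ?_
    rw [Finset.mem_range] at hj
    rw [show s + 1 - 1 - j = s - j by omega, show s - (s - j) = j by omega,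
      Nat.cast_sub (by omega), mul_comm (a (s - j))]
  have hdouble : S + S = 2 * (Complex.exp (Real.pi * m / r * s * Complex.I) *
      truncForm (cosCoeff r m s) s 0 a) := by
    conv_lhs => rw [hrefl]
    conv_lhs => enter [1]; rw [← hrefl, hS]
    rw [← Finset.sum_add_distrib, truncForm, ← Finset.range_eq_Ico, Finset.mul_sum, Finset.mul_sum,
      Nat.sub_zero]
    refine Finset.sum_congr rfl fun j _ => ?_
    rw [Complex.real_smul, cosCoeff]
    push_cast
    rw [Complex.cos]
    have e1 : Complex.exp (Real.pi * m / r * (2 * j) * Complex.I) =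
        Complex.exp (Real.pi * m / r * s * Complex.I) *
          Complex.exp (-(Real.pi * m * (s - 2 * j) / r) * Complex.I) := by
      rw [← Complex.exp_add]; congr 1; ring
    have e2 : Complex.exp (Real.pi * m / r * (2 * (s - j)) * Complex.I) =
        Complex.exp (Real.pi * m / r * s * Complex.I) *
          Complex.exp ((Real.pi * m * (s - 2 * j) / r) * Complex.I) := by
      rw [← Complex.exp_add]; congr 1; ring
    rw [e1, e2]
    ring
  linear_combination hdouble / 2

/-- For a bandlimited signal with `s < N`, no frequency wraps around, and the FROG trace at
frequency `2 i + s` is the modulus of a quadratic form in the Fourier coefficients of the band. -/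
lemma frogTrace_eq {L B : ℕ} (hL : L ∣ N) (hB : 2 * B ≤ N) {i : ZMod N} {x : ZMod N → ℂ}
    (hx : IsBandlimitedAt B i x) {s : ℕ} (hs : s < N) (m : ℕ) :
    frogTrace L x (2 * i + (s : ZMod N)) m =
      ((N : ℝ)⁻¹ * ‖truncForm (cosCoeff (N / L) m s) s 0 (bandSeq B i x)‖) ^ 2 := by
  have hN : (N : ℂ) ≠ 0 := Nat.cast_ne_zero.mpr (NeZero.ne N)
  have hL0 : L ≠ 0 := by
    rintro rfl
    exact NeZero.ne N (zero_dvd_iff.mp hL)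
  have hchar : ∀ j : ℕ, ZMod.stdAddChar ((j : ZMod N) * ((m * L : ℕ) : ZMod N)) =
      Complex.exp (Real.pi * m / (N / L : ℕ) * (2 * j) * Complex.I) := by
    intro j
    have h := ZMod.stdAddChar_coe (N := N) ((j * (m * L) : ℕ) : ℤ)
    push_cast at h
    push_cast
    rw [h]
    congr 1
    obtain ⟨q, hq⟩ := hL
    have hLc : (L : ℂ) ≠ 0 := Nat.cast_ne_zero.mpr hL0
    have hqc : (q : ℂ) ≠ 0 := by
      intro h0
      apply hN
      rw [hq, Nat.cast_mul, h0, mul_zero]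
    rw [hq, Nat.mul_div_cancel_left q (Nat.pos_of_ne_zero hL0)]
    push_cast
    field_simp
  have hterm : ∀ j ∈ Finset.range N,
      ZMod.stdAddChar ((i + (j : ZMod N)) * ((m * L : ℕ) : ZMod N)) *
        (ZMod.dft x (i + (j : ZMod N)) * ZMod.dft x (2 * i + (s : ZMod N) - (i + (j : ZMod N)))) =
      if j < s + 1 then ZMod.stdAddChar (i * ((m * L : ℕ) : ZMod N)) *
        (Complex.exp (Real.pi * m / (N / L : ℕ) * (2 * j) * Complex.I) *
          (bandSeq B i x j * bandSeq B i x (s - j))) else 0 := by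
    intro j hj
    rw [Finset.mem_range] at hj
    rw [add_mul, AddChar.map_add_eq_mul, hchar, ← bandSeq_eq_dft hx hj]
    split_ifs with hjs
    · rw [show 2 * i + (s : ZMod N) - (i + (j : ZMod N)) = i + ((s - j : ℕ) : ZMod N) by
        rw [Nat.cast_sub (by omega)]; ring, ← bandSeq_eq_dft hx (by omega)]
      ring
    · by_cases hjB : j < B
      · rw [show 2 * i + (s : ZMod N) - (i + (j : ZMod N)) = i + ((N + s - j : ℕ) : ZMod N) by
          rw [Nat.cast_sub (by omega), Nat.cast_add, ZMod.natCast_self]; ring,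
          hx _ (by omega) (by omega)]
        ring
      · rw [bandSeq_eq_zero (not_lt.mp hjB)]; ring
  have hsum : ∑ l, ZMod.stdAddChar (l * ((m * L : ℕ) : ZMod N)) *
      (ZMod.dft x l * ZMod.dft x (2 * i + (s : ZMod N) - l)) =
      ZMod.stdAddChar (i * ((m * L : ℕ) : ZMod N)) *
        (Complex.exp (Real.pi * m / (N / L : ℕ) * s * Complex.I) *
          truncForm (cosCoeff (N / L) m s) s 0 (bandSeq B i x)) := by
    rw [sum_eq_sum_range_add i, Finset.sum_congr rfl hterm, ← sum_exp_eq_truncForm, Finset.mul_sum,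
      ← Finset.sum_filter]
    congr 1
    ext j
    simp only [Finset.mem_filter, Finset.mem_range]
    omega
  have hexp : ‖Complex.exp (Real.pi * m / (N / L : ℕ) * s * Complex.I)‖ = 1 := by
    have := Complex.norm_exp_ofReal_mul_I (Real.pi * m / (N / L : ℕ) * s)
    push_cast at this
    exact this
  unfold frogTrace
  rw [dft_mul_shift, hsum, norm_mul, norm_mul, norm_mul, hexp, AddChar.norm_apply, norm_inv,
    Complex.norm_natCast, one_mul, one_mul]

lemma norm_truncForm_eq_of_frogTrace_eq {L B : ℕ} (hL : L ∣ N) (hB : 2 * B ≤ N) {i : ZMod N}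
    {x z : ZMod N → ℂ} (hx : IsBandlimitedAt B i x) (hz : IsBandlimitedAt B i z) {s : ℕ}
    (hs : s < N) {m : ℕ}
    (h : frogTrace L z (2 * i + (s : ZMod N)) m = frogTrace L x (2 * i + (s : ZMod N)) m) :
    ‖truncForm (cosCoeff (N / L) m s) s 0 (bandSeq B i z)‖ =
      ‖truncForm (cosCoeff (N / L) m s) s 0 (bandSeq B i x)‖ := by
  have hN : 0 < (N : ℝ)⁻¹ := inv_pos.mpr (Nat.cast_pos.mpr (NeZero.pos N))
  rw [frogTrace_eq hL hB hx hs, frogTrace_eq hL hB hz hs,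
    sq_eq_sq₀ (by positivity) (by positivity)] at h
  exact mul_left_cancel₀ hN.ne' h

lemma dft_reflectSignal (x : ZMod N → ℂ) (k : ZMod N) :
    ZMod.dft (reflectSignal x) k = (starRingEnd ℂ) (ZMod.dft x k) := by
  rw [ZMod.dft_apply, ZMod.dft_apply, map_sum]
  refine Fintype.sum_equiv (Equiv.neg _) _ _ fun n => ?_
  simp only [reflectSignal, smul_eq_mul, map_mul, Equiv.neg_apply]
  congr 1
  rw [← AddChar.map_neg_eq_conj]
  congr 1
  ring

lemma exists_rotate_translate_eq {B : ℕ} {i : ZMod N} {x z : ZMod N → ℂ}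
    (hx : ∀ j : ℕ, B ≤ j → j < N → ZMod.dft x (i + (j : ZMod N)) = 0)
    (hz : IsBandlimitedAt B i z) {u v : ℂ} (hu : ‖u‖ = 1) (hv : ‖v‖ = 1)
    (h : ∀ j < B, ZMod.dft z (i + (j : ZMod N)) = u * v ^ j * ZMod.dft x (i + (j : ZMod N))) :
    ∃ φ ψ : ℝ, z = rotateSignal φ (translateSignal i ψ x) := by
  obtain ⟨α, rfl⟩ := (Complex.norm_eq_one_iff u).mp hu
  obtain ⟨ψ, rfl⟩ := (Complex.norm_eq_one_iff v).mp hv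
  refine ⟨α - ψ * i.val, ψ, ?_⟩
  apply ZMod.dft.injective
  funext k
  have hrot : ZMod.dft (rotateSignal (α - ψ * i.val) (translateSignal i ψ x)) k =
      Complex.exp (Complex.I * ((α - ψ * i.val : ℝ) : ℂ)) *
        (Complex.exp (Complex.I * ψ * (liftedFreq i k : ℂ)) * ZMod.dft x k) := by
    unfold rotateSignal translateSignal
    rw [ZMod.dft_const_mul, LinearEquiv.apply_symm_apply]
  rw [hrot]
  obtain ⟨j, hjN, rfl⟩ : ∃ j < N, k = i + (j : ZMod N) :=
    ⟨(k - i).val, ZMod.val_lt _, by simp⟩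
  by_cases hj : j < B
  · rw [h j hj, ← mul_assoc, ← Complex.exp_add, ← Complex.exp_nat_mul, ← Complex.exp_add]
    congr 2
    rw [liftedFreq, add_sub_cancel_left, ZMod.val_cast_of_lt hjN]
    push_cast
    ring
  · rw [hz j (not_lt.mp hj) hjN, hx j (not_lt.mp hj) hjN, mul_zero, mul_zero]

lemma triviallyEquivalent_of_bandSeq {B : ℕ} (hB : 2 * B ≤ N) {i : ZMod N} {x z : ZMod N → ℂ}
    (hx : IsBandlimitedAt B i x) (hz : IsBandlimitedAt B i z) {u v : ℂ} (hu : ‖u‖ = 1)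
    (hv : ‖v‖ = 1) (h : (∀ j, bandSeq B i z j = u * v ^ j * bandSeq B i x j) ∨
      ∀ j, bandSeq B i z j = u * v ^ j * (starRingEnd ℂ) (bandSeq B i x j)) :
    TriviallyEquivalent i x z := by
  rcases h with h | h
  · obtain ⟨φ, ψ, e⟩ := exists_rotate_translate_eq (x := x) hx hz hu hv fun j hj => by
      rw [← bandSeq_eq_dft hz (by omega), ← bandSeq_eq_dft hx (by omega), h j]
    exact ⟨φ, ψ, Or.inl e⟩
  · obtain ⟨φ, ψ, e⟩ := exists_rotate_translate_eq (x := reflectSignal x)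
      (fun j h1 h2 => by rw [dft_reflectSignal, hx j h1 h2, map_zero]) hz hu hv fun j hj => by
      rw [← bandSeq_eq_dft hz (by omega), dft_reflectSignal, ← bandSeq_eq_dft hx (by omega), h j]
    exact ⟨φ, ψ, Or.inr e⟩

end Signals

/-! ### Cosines of the coefficient angles -/

lemma cosCoeff_zero (r s j : ℕ) : cosCoeff r 0 s j = 1 := by simp [cosCoeff]

lemma cosCoeff_two (r s j : ℕ) : cosCoeff r 2 s j = 2 * cosCoeff r 1 s j ^ 2 - 1 := by
  unfold cosCoeff
  rw [← Real.cos_two_mul]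
  congr 1
  push_cast
  ring

lemma cosCoeff_one_eq_zero_iff {r : ℕ} (hr : 0 < r) (s j : ℕ) :
    cosCoeff r 1 s j = 0 ↔ ∃ k : ℤ, 2 * ((s : ℤ) - 2 * j) = (2 * k + 1) * r := by
  have hr' : (r : ℝ) ≠ 0 := by positivity
  unfold cosCoeff
  rw [Real.cos_eq_zero_iff]
  refine exists_congr fun k => ?_
  rw [← @Int.cast_inj ℝ]
  push_cast
  have hpi := Real.pi_ne_zero
  constructor
  · intro h
    field_simp at h
    linear_combination h
  · intro h
    field_simp
    linear_combination h

lemma cosCoeff_two_eq_zero_iff {r : ℕ} (hr : 0 < r) (s j : ℕ) :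
    cosCoeff r 2 s j = 0 ↔ ∃ k : ℤ, 4 * ((s : ℤ) - 2 * j) = (2 * k + 1) * r := by
  have hr' : (r : ℝ) ≠ 0 := by positivity
  unfold cosCoeff
  rw [Real.cos_eq_zero_iff]
  refine exists_congr fun k => ?_
  rw [← @Int.cast_inj ℝ]
  push_cast
  have hpi := Real.pi_ne_zero
  constructor
  · intro h
    field_simp at h
    linear_combination h
  · intro h
    field_simp
    linear_combination h

lemma cosCoeff_one_ne {r : ℕ} (hr : 0 < r) {s i j : ℕ} (h1 : ¬ (r : ℤ) ∣ (i : ℤ) - j)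
    (h2 : ¬ (r : ℤ) ∣ (s : ℤ) - i - j) : cosCoeff r 1 s i ≠ cosCoeff r 1 s j := by
  have hr' : (r : ℝ) ≠ 0 := by positivity
  have hpi := Real.pi_ne_zero
  unfold cosCoeff
  rw [ne_eq, Real.cos_eq_cos_iff]
  rintro ⟨k, h | h⟩
  · apply h1
    refine ⟨k, ?_⟩
    rw [← @Int.cast_inj ℝ]
    push_cast at h ⊢
    field_simp at h
    linear_combination h / 2
  · apply h2
    refine ⟨k, ?_⟩
    rw [← @Int.cast_inj ℝ]
    push_cast at h ⊢
    field_simp at h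
    linear_combination h / 2

lemma eq_zero_of_dvd_of_lt {r : ℕ} {d : ℤ} (h : (r : ℤ) ∣ d) (h1 : -(r : ℤ) < d)
    (h2 : d < r) : d = 0 :=
  Int.eq_zero_of_abs_lt_dvd h (abs_lt.mpr ⟨h1, h2⟩)

/-- The forms measured by the FROG trace at `m = 0, 1, 2`. -/
noncomputable def frogCoeff (r : ℕ) : Fin 3 → ℕ → ℕ → ℝ := ![cosCoeff r 0, cosCoeff r 1, cosCoeff r 2]

/-- The form `2 * a 0 * a s`, which is known from the power spectrum. -/
def edgeCoeff (s j : ℕ) : ℝ := if j = 0 ∨ j = s then 1 else 0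

/-- The forms measured by the FROG trace at `m = 0, 1` and by the power spectrum. -/
noncomputable def spectrumCoeff (r : ℕ) : Fin 3 → ℕ → ℕ → ℝ :=
  ![cosCoeff r 0, cosCoeff r 1, edgeCoeff]

lemma frogCoeff_symm (r : ℕ) : ∀ μ s j, j ≤ s → frogCoeff r μ s (s - j) = frogCoeff r μ s j := by
  intro μ s j h
  fin_cases μ <;> exact cosCoeff_symm r _ h

lemma spectrumCoeff_symm (r : ℕ) :
    ∀ μ s j, j ≤ s → spectrumCoeff r μ s (s - j) = spectrumCoeff r μ s j := by
  intro μ s j h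
  fin_cases μ
  · exact cosCoeff_symm r _ h
  · exact cosCoeff_symm r _ h
  · change edgeCoeff s (s - j) = edgeCoeff s j
    unfold edgeCoeff
    congr 1
    apply propext
    omega

section Frog

variable {r : ℕ}

lemma threeCircles_frogCoeff_of_ne {s k l : ℕ} (hk : 1 ≤ k ∧ k < s) (hl : 1 ≤ l ∧ l < s)
    (h1 : cosCoeff r 1 s 0 ≠ 0) (h2 : cosCoeff r 2 s 0 ≠ 0)
    (h0k : cosCoeff r 1 s 0 ≠ cosCoeff r 1 s k) (h0l : cosCoeff r 1 s 0 ≠ cosCoeff r 1 s l)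
    (hkl : cosCoeff r 1 s k ≠ cosCoeff r 1 s l) : ThreeCircles (frogCoeff r) s := by
  refine ⟨?_, k, l, hk, hl, ?_⟩
  · intro μ
    fin_cases μ
    · change cosCoeff r 0 s 0 ≠ 0
      rw [cosCoeff_zero]; exact one_ne_zero
    · exact h1
    · exact h2
  · have : Matrix.det (Matrix.of fun μ => ![frogCoeff r μ s 0, frogCoeff r μ s k, frogCoeff r μ s l]) =
        2 * ((cosCoeff r 1 s 0 - cosCoeff r 1 s k) * (cosCoeff r 1 s 0 - cosCoeff r 1 s l) *
          (cosCoeff r 1 s l - cosCoeff r 1 s k)) := by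
      simp only [Matrix.det_fin_three, Matrix.of_apply, Matrix.cons_val, frogCoeff, cosCoeff_zero,
        cosCoeff_two]
      ring
    rw [this]
    exact mul_ne_zero two_ne_zero (mul_ne_zero (mul_ne_zero (sub_ne_zero.mpr h0k)
      (sub_ne_zero.mpr h0l)) (sub_ne_zero.mpr hkl.symm))

/-- Apart from the vanishing of a leading coefficient, three circles are available in every degree
`s ≥ 4`, since at least three of the angles `π (s - 2 j) / r` have distinct cosines. -/
lemma threeCircles_frogCoeff (hr : 4 ≤ r) {s : ℕ} (hs : 4 ≤ s)
    (hrs : 5 ≤ r ∨ (r : ℤ) ∣ s) (h1 : cosCoeff r 1 s 0 ≠ 0) (h2 : cosCoeff r 2 s 0 ≠ 0) :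
    ThreeCircles (frogCoeff r) s := by
  have hr0 : 0 < r := by omega
  have large : ∀ d : ℤ, (r : ℤ) ∣ (s : ℤ) - d → 1 ≤ d → d ≤ 3 → 5 ≤ r ∧ s ≥ r + d := by
    intro d hd hd1 hd3
    have hle := Int.le_of_dvd (by omega) hd
    rcases hrs with h | h
    · omega
    · have := eq_zero_of_dvd_of_lt (dvd_sub h hd) (by omega) (by omega)
      omega
  have sep : ∀ i j d : ℕ, (r : ℤ) ∣ (s : ℤ) - d → (i : ℤ) - j ≠ 0 → (d : ℤ) - i - j ≠ 0 →
      -(r : ℤ) < (i : ℤ) - j → (i : ℤ) - j < r → -(r : ℤ) < (d : ℤ) - i - j →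
      (d : ℤ) - i - j < r → cosCoeff r 1 s i ≠ cosCoeff r 1 s j := by
    intro i j d hd g1 g2 g3 g4 g5 g6
    refine cosCoeff_one_ne hr0 (fun h => g1 (eq_zero_of_dvd_of_lt h g3 g4)) fun h => g2 ?_
    refine eq_zero_of_dvd_of_lt ?_ g5 g6
    have := dvd_sub h hd
    rwa [show (s : ℤ) - i - j - (s - d) = d - i - j by ring] at this
  -- two of the indices `0, 1, 2` have the same cosine only if `s ≡ 1, 2, 3` modulo `r`
  by_cases d1 : (r : ℤ) ∣ (s : ℤ) - (1 : ℕ)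
  · have := large _ d1 (by simp) (by simp)
    exact threeCircles_frogCoeff_of_ne (k := 2) (l := 3) (by omega) (by omega) h1 h2
      (sep 0 2 1 d1 (by omega) (by omega) (by omega) (by omega) (by omega) (by omega))
      (sep 0 3 1 d1 (by omega) (by omega) (by omega) (by omega) (by omega) (by omega))
      (sep 2 3 1 d1 (by omega) (by omega) (by omega) (by omega) (by omega) (by omega))
  by_cases d2 : (r : ℤ) ∣ (s : ℤ) - (2 : ℕ)
  · have := large _ d2 (by simp) (by simp)
    exact threeCircles_frogCoeff_of_ne (k := 1) (l := 3) (by omega) (by omega) h1 h2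
      (sep 0 1 2 d2 (by omega) (by omega) (by omega) (by omega) (by omega) (by omega))
      (sep 0 3 2 d2 (by omega) (by omega) (by omega) (by omega) (by omega) (by omega))
      (sep 1 3 2 d2 (by omega) (by omega) (by omega) (by omega) (by omega) (by omega))
  by_cases d3 : (r : ℤ) ∣ (s : ℤ) - (3 : ℕ)
  · have := large _ d3 (by simp) (by simp)
    exact threeCircles_frogCoeff_of_ne (k := 1) (l := 4) (by omega) (by omega) h1 h2
      (sep 0 1 3 d3 (by omega) (by omega) (by omega) (by omega) (by omega) (by omega))
      (sep 0 4 3 d3 (by omega) (by omega) (by omega) (by omega) (by omega) (by omega))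
      (sep 1 4 3 d3 (by omega) (by omega) (by omega) (by omega) (by omega) (by omega))
  · have nd : ∀ i j : ℕ, (i : ℤ) - j ≠ 0 → -4 < (i : ℤ) - j → (i : ℤ) - j < 4 →
        ¬ (r : ℤ) ∣ (i : ℤ) - j := fun i j g1 g2 g3 h =>
      g1 (eq_zero_of_dvd_of_lt h (by omega) (by omega))
    refine threeCircles_frogCoeff_of_ne (k := 1) (l := 2) (by omega) (by omega) h1 h2
      (cosCoeff_one_ne hr0 (nd 0 1 (by omega) (by omega) (by omega)) ?_)
      (cosCoeff_one_ne hr0 (nd 0 2 (by omega) (by omega) (by omega)) ?_)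
      (cosCoeff_one_ne hr0 (nd 1 2 (by omega) (by omega) (by omega)) ?_)
    · simpa using d1
    · simpa using d2
    · rw [show (s : ℤ) - (1 : ℕ) - (2 : ℕ) = s - (3 : ℕ) by push_cast; ring]
      exact d3

lemma twoCircles_frogCoeff_one (hr : 4 ≤ r) {s : ℕ} (hs : 2 ≤ s) (h1 : cosCoeff r 1 s 0 ≠ 0) :
    TwoCircles (frogCoeff r) 0 1 s := by
  have hr0 : 0 < r := by omega
  have key : ∃ k, 1 ≤ k ∧ k < s ∧ cosCoeff r 1 s 0 ≠ cosCoeff r 1 s k := by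
    by_cases d1 : (r : ℤ) ∣ (s : ℤ) - 1
    · have hle := Int.le_of_dvd (by omega) d1
      refine ⟨2, by omega, by omega, cosCoeff_one_ne hr0 (fun h => ?_) fun h => ?_⟩
      · have := eq_zero_of_dvd_of_lt h (by omega) (by omega)
        omega
      · have := eq_zero_of_dvd_of_lt (dvd_sub h d1) (by omega) (by omega)
        omega
    · refine ⟨1, le_rfl, by omega, cosCoeff_one_ne hr0 (fun h => ?_) fun h => d1 ?_⟩
      · have := eq_zero_of_dvd_of_lt h (by omega) (by omega)
        omega
      · simpa using h
  obtain ⟨k, hk1, hk2, hk⟩ := key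
  refine ⟨?_, h1, k, hk1, hk2, ?_⟩
  · change cosCoeff r 0 s 0 ≠ 0
    rw [cosCoeff_zero]; exact one_ne_zero
  · change cosCoeff r 0 s k * cosCoeff r 1 s 0 ≠ cosCoeff r 1 s k * cosCoeff r 0 s 0
    rw [cosCoeff_zero, cosCoeff_zero, one_mul, mul_one]
    exact hk

lemma twoCircles_frogCoeff_two (hr : 4 ≤ r) {s : ℕ} (hs : 2 ≤ s) (h1 : cosCoeff r 1 s 0 = 0) :
    TwoCircles (frogCoeff r) 0 2 s := by
  have hr0 : 0 < r := by omega
  refine ⟨?_, ?_, 1, le_rfl, by omega, ?_⟩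
  · change cosCoeff r 0 s 0 ≠ 0
    rw [cosCoeff_zero]; exact one_ne_zero
  · change cosCoeff r 2 s 0 ≠ 0
    rw [cosCoeff_two, h1]; norm_num
  · change cosCoeff r 0 s 1 * cosCoeff r 2 s 0 ≠ cosCoeff r 2 s 1 * cosCoeff r 0 s 0
    rw [cosCoeff_zero, cosCoeff_zero, cosCoeff_two, cosCoeff_two, h1]
    intro h
    have h0 : cosCoeff r 1 s 1 = 0 := by
      have : cosCoeff r 1 s 1 ^ 2 = 0 := by linarith
      exact pow_eq_zero_iff (two_ne_zero) |>.mp this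
    obtain ⟨k, hk⟩ := (cosCoeff_one_eq_zero_iff hr0 s 0).mp h1
    obtain ⟨l, hl⟩ := (cosCoeff_one_eq_zero_iff hr0 s 1).mp h0
    have hd : (r : ℤ) ∣ 2 := ⟨k - l, by push_cast at hk hl; linarith⟩
    have := eq_zero_of_dvd_of_lt hd (by omega) (by omega)
    omega

lemma exists_twoCircles_frogCoeff (hr : 4 ≤ r) {s : ℕ} (hs : 2 ≤ s) :
    ∃ ν, TwoCircles (frogCoeff r) 0 ν s := by
  by_cases h1 : cosCoeff r 1 s 0 = 0
  · exact ⟨2, twoCircles_frogCoeff_two hr hs h1⟩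
  · exact ⟨1, twoCircles_frogCoeff_one hr hs h1⟩

end Frog

/-- At the upper end of the band the form `∑ a j * a (B - j)` has no leading term. -/
lemma resolvable_of_succ_eq {B s : ℕ} {c : Fin 3 → ℕ → ℕ → ℝ} (hc : ∀ j, c 0 (s + 1) j = 1)
    (hs : 3 ≤ s) (hB : s + 1 = B) {μ ν : Fin 3} (h : TwoCircles c μ ν s) : Resolvable B c s :=
  Or.inr ⟨μ, ν, 1, c 0 (s + 1), h, le_rfl, by omega, by omega,
    Or.inl ⟨0, rfl, fun h => by omega⟩, by rw [hc]; exact one_ne_zero, fun j h1 h2 => by omega,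
    Or.inl ⟨2, by omega, by omega, by rw [hc]; exact one_ne_zero⟩⟩

lemma resolvable_of_leading_eq_zero {B s q : ℕ} {c : Fin 3 → ℕ → ℕ → ℝ} (κ : Fin 3) (hs : 3 ≤ s)
    (hB : s + 1 ≤ B) {μ ν : Fin 3} (h : TwoCircles c μ ν s) (h0 : c κ (s + 1) 0 = 0)
    (h1 : c κ (s + 1) 1 ≠ 0) (hq : 1 < q) (hqs : q < s) (h2 : c κ (s + 1) q ≠ 0) :
    Resolvable B c s :=
  Or.inr ⟨μ, ν, 1, c κ (s + 1), h, le_rfl, by omega, hB,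
    Or.inl ⟨κ, rfl, fun _ => h0⟩, h1, fun j h1 h2 => by omega, Or.inl ⟨q, hq, hqs, h2⟩⟩

/-- Three circles in the next degree provide the combination `cos (π (s + 1) / r)` times the form
`m = 0` minus the form `m = 1`, which has no leading term. -/
lemma resolvable_frogCoeff_of_three_succ {r B s : ℕ} (hr : 4 ≤ r) (hs : 3 ≤ s) (hB : s + 1 < B)
    {μ ν : Fin 3} (h : TwoCircles (frogCoeff r) μ ν s)
    (hthree : ThreeCircles (frogCoeff r) (s + 1)) (d0 : ¬ (r : ℤ) ∣ (s : ℤ))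
    (d1 : ¬ (r : ℤ) ∣ (s : ℤ) - 1) : Resolvable B (frogCoeff r) s := by
  have hr0 : 0 < r := by omega
  have he : ∀ j, ∑ i, (![cosCoeff r 1 (s + 1) 0, -1, 0] : Fin 3 → ℝ) i *
      frogCoeff r i (s + 1) j = cosCoeff r 1 (s + 1) 0 - cosCoeff r 1 (s + 1) j := by
    intro j
    simp only [Fin.sum_univ_three, Matrix.cons_val, frogCoeff, cosCoeff_zero]
    ring
  refine Or.inr ⟨μ, ν, 1, _, h, le_rfl, by omega, hB.le,
    Or.inr ⟨hB, hthree, ?_, ![cosCoeff r 1 (s + 1) 0, -1, 0], rfl⟩, ?_, fun j h1 h2 => by omega,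
    Or.inl ⟨2, by omega, by omega, ?_⟩⟩
  · rw [he, sub_self]
  · rw [he, sub_ne_zero]
    refine cosCoeff_one_ne hr0 (fun h => ?_) fun h => d0 (by simpa using h)
    have := eq_zero_of_dvd_of_lt h (by omega) (by omega)
    omega
  · rw [he, sub_ne_zero]
    refine cosCoeff_one_ne hr0 (fun h => ?_) fun h => d1 ?_
    · have := eq_zero_of_dvd_of_lt h (by omega) (by omega)
      omega
    · rwa [show ((s + 1 : ℕ) : ℤ) - (0 : ℕ) - (2 : ℕ) = s - 1 by push_cast; ring] at h

/-- The index `3` is too small for three circles. If the form `m = 1` of degree `4` has no leading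
term, then its coefficients of index `1` and `2` do not vanish, and it serves as third condition. -/
lemma resolvable_three {r B : ℕ} {c : Fin 3 → ℕ → ℕ → ℝ} (hr : 0 < r) (hB : 4 ≤ B) {μ ν : Fin 3}
    (h : TwoCircles c μ ν 3) (hc : c 1 = cosCoeff r 1) (h0 : cosCoeff r 1 4 0 = 0) :
    Resolvable B c 3 := by
  refine resolvable_of_leading_eq_zero (q := 2) 1 le_rfl hB h (by rw [hc]; exact h0) ?_ (by omega)
    (by omega) ?_
  · rw [hc]
    intro h1
    obtain ⟨k, hk⟩ := (cosCoeff_one_eq_zero_iff hr 4 0).mp h0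
    obtain ⟨l, hl⟩ := (cosCoeff_one_eq_zero_iff hr 4 1).mp h1
    have hr' : (r : ℤ) ≠ 0 := by omega
    have : (2 * k + 1) = 2 * (2 * l + 1) := by
      apply mul_right_cancel₀ hr'
      push_cast at hk hl
      linarith
    omega
  · rw [hc]
    norm_num [cosCoeff]

/-- A degree `s ≥ 4` without three circles satisfies `2 s = (2 k + 1) r` or `4 s = (2 k + 1) r`, and
then the degree `s + 1` does not, as `r ≥ 5` does not divide `4`. -/
lemma resolvable_frogCoeff_of_five_le {r B s : ℕ} (hr : 5 ≤ r) (hs : 3 ≤ s) (hB : s < B) :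
    Resolvable B (frogCoeff r) s := by
  have hr0 : 0 < r := by omega
  have hr' : (r : ℤ) ≠ 0 := by omega
  by_cases hreg : 4 ≤ s ∧ cosCoeff r 1 s 0 ≠ 0 ∧ cosCoeff r 2 s 0 ≠ 0
  · exact Or.inl (threeCircles_frogCoeff (by omega) hreg.1 (Or.inl hr) hreg.2.1 hreg.2.2)
  obtain ⟨ν, htwo⟩ := exists_twoCircles_frogCoeff (r := r) (by omega) (show 2 ≤ s by omega)
  rcases (show s + 1 ≤ B from hB).eq_or_lt with hB' | hB'
  · exact resolvable_of_succ_eq (fun j => cosCoeff_zero _ _ _) hs hB' htwo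
  have hcases : s = 3 ∨ (∃ k : ℤ, 2 * (s : ℤ) = (2 * k + 1) * r) ∨
      ∃ k : ℤ, 4 * (s : ℤ) = (2 * k + 1) * r := by
    by_cases h4 : 4 ≤ s
    · by_cases h1 : cosCoeff r 1 s 0 = 0
      · obtain ⟨k, hk⟩ := (cosCoeff_one_eq_zero_iff hr0 s 0).mp h1
        exact Or.inr (Or.inl ⟨k, by rw [← hk]; push_cast; ring⟩)
      · by_cases h2 : cosCoeff r 2 s 0 = 0
        · obtain ⟨k, hk⟩ := (cosCoeff_two_eq_zero_iff hr0 s 0).mp h2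
          exact Or.inr (Or.inr ⟨k, by rw [← hk]; push_cast; ring⟩)
        · exact absurd ⟨h4, h1, h2⟩ hreg
    · left; omega
  have nd4 : ¬ (r : ℤ) ∣ 4 := fun h => by
    have := eq_zero_of_dvd_of_lt h (by omega) (by omega)
    omega
  have nd2 : ¬ (r : ℤ) ∣ 2 := fun h => nd4 (h.trans ⟨2, rfl⟩)
  have parity : ∀ k l : ℤ, (2 * k) * (r : ℤ) ≠ (2 * l + 1) * r := fun k l h => by
    have := mul_right_cancel₀ hr' h
    omega
  by_cases t1 : cosCoeff r 1 (s + 1) 0 = 0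
  · obtain ⟨l, hl⟩ := (cosCoeff_one_eq_zero_iff hr0 (s + 1) 0).mp t1
    push_cast at hl
    rcases hcases with rfl | ⟨k, hk⟩ | ⟨k, hk⟩
    · exact resolvable_three hr0 hB htwo rfl t1
    · exact absurd ⟨2 * (l - k), by linarith⟩ nd2
    · exact absurd ⟨2 * (2 * l + 1) - (2 * k + 1), by linarith⟩ nd4
  by_cases t2 : cosCoeff r 2 (s + 1) 0 = 0
  · obtain ⟨l, hl⟩ := (cosCoeff_two_eq_zero_iff hr0 (s + 1) 0).mp t2
    push_cast at hl
    rcases hcases with rfl | ⟨k, hk⟩ | ⟨k, hk⟩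
    · refine resolvable_of_leading_eq_zero (q := 2) 2 le_rfl hB htwo t2 ?_ (by omega) (by omega) ?_
      · intro h1
        obtain ⟨k, hk⟩ := (cosCoeff_two_eq_zero_iff hr0 4 1).mp h1
        push_cast at hk hl
        exact parity (2 * k + 1) l (by linarith)
      · change cosCoeff r 2 4 2 ≠ 0
        norm_num [cosCoeff]
    · exact absurd ⟨2 * l + 1 - 2 * (2 * k + 1), by linarith⟩ nd4
    · exact absurd ⟨2 * l - 2 * k, by linarith⟩ nd4
  refine resolvable_frogCoeff_of_three_succ (by omega) hs hB' htwo
    (threeCircles_frogCoeff (by omega) (by omega) (Or.inl hr) t1 t2) ?_ ?_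
  · rintro ⟨q, hq⟩
    rcases hcases with rfl | ⟨k, hk⟩ | ⟨k, hk⟩
    · have := eq_zero_of_dvd_of_lt ⟨q, hq⟩ (by omega) (by omega)
      omega
    · exact parity q k (by rw [← hk, hq]; ring)
    · exact parity (2 * q) k (by rw [← hk, hq]; ring)
  · rintro ⟨q, hq⟩
    rcases hcases with rfl | ⟨k, hk⟩ | ⟨k, hk⟩
    · exact nd2 ⟨q, by push_cast at hq; linarith⟩
    · exact nd2 ⟨2 * k + 1 - 2 * q, by linarith⟩
    · exact nd4 ⟨2 * k + 1 - 4 * q, by linarith⟩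

/-- For `r = 4` the form `m = 2` vanishes in odd degrees, and `m = 1` has no leading term in degrees
`≡ 2` modulo `4`. In the latter degrees one has to look two degrees ahead: the forms `m = 0, 1, 2`
of degree `s + 2`, combined with the coefficients `1`, `-2 cos (π (s + 2) / 4)`, `1`, contain neither
`a 0 * a (s + 2)` nor `a 1 * a (s + 1)`. -/
lemma resolvable_frogCoeff_four {B s : ℕ} (hs : 3 ≤ s) (hB : s < B) :
    Resolvable B (frogCoeff 4) s := by
  have z1 : ∀ s j : ℕ, cosCoeff 4 1 s j = 0 ↔ ∃ k : ℤ, 2 * ((s : ℤ) - 2 * j) = (2 * k + 1) * 4 :=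
    fun s j => cosCoeff_one_eq_zero_iff (by omega) s j
  have z2 : ∀ s j : ℕ, cosCoeff 4 2 s j = 0 ↔ ∃ k : ℤ, 4 * ((s : ℤ) - 2 * j) = (2 * k + 1) * 4 :=
    fun s j => cosCoeff_two_eq_zero_iff (by omega) s j
  have three : ∀ t, 4 ≤ t → t % 4 = 0 → ThreeCircles (frogCoeff 4) t := by
    intro t ht htm
    refine threeCircles_frogCoeff le_rfl ht (Or.inr (by omega)) ?_ ?_
    · rw [ne_eq, z1]; rintro ⟨k, hk⟩; omega
    · rw [ne_eq, z2]; rintro ⟨k, hk⟩; omega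
  have hmod : s % 4 = 0 ∨ s % 4 = 1 ∨ s % 4 = 2 ∨ s % 4 = 3 := by omega
  rcases hmod with hm | hm | hm | hm
  · exact Or.inl (three s (by omega) hm)
  · have htwo := twoCircles_frogCoeff_one (r := 4) le_rfl (show 2 ≤ s by omega) (by
      rw [ne_eq, z1]; rintro ⟨k, hk⟩; omega)
    refine resolvable_of_leading_eq_zero (q := 3) 1 hs hB htwo ?_ ?_ (by omega) (by omega) ?_
    · exact (z1 _ _).mpr ⟨s / 4, by omega⟩
    · change cosCoeff 4 1 (s + 1) 1 ≠ 0
      rw [ne_eq, z1]; rintro ⟨k, hk⟩; omega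
    · change cosCoeff 4 1 (s + 1) 3 ≠ 0
      rw [ne_eq, z1]; rintro ⟨k, hk⟩; omega
  · have htwo := twoCircles_frogCoeff_two (r := 4) le_rfl (show 2 ≤ s by omega)
      ((z1 _ _).mpr ⟨s / 4, by omega⟩)
    rcases (show s + 1 ≤ B from hB).eq_or_lt with hB' | hB'
    · exact resolvable_of_succ_eq (fun j => cosCoeff_zero _ _ _) hs hB' htwo
    rcases (show s + 2 ≤ B from hB').eq_or_lt with hB'' | hB''
    · refine Or.inr ⟨0, 2, 2, cosCoeff 4 1 (s + 2), htwo, by omega, by omega, by omega,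
        Or.inl ⟨1, rfl, fun h => by omega⟩, ?_, ?_, Or.inl ⟨4, by omega, by omega, ?_⟩⟩
      · rw [ne_eq, z1]; rintro ⟨k, hk⟩; omega
      · intro j h1 h2
        obtain rfl : j = 1 := by omega
        exact (z1 _ _).mpr ⟨s / 4, by omega⟩
      · rw [ne_eq, z1]; rintro ⟨k, hk⟩; omega
    · have he : ∀ j, ∑ i, (![1, -2 * cosCoeff 4 1 (s + 2) 0, 1] : Fin 3 → ℝ) i *
          frogCoeff 4 i (s + 2) j =
          2 * (cosCoeff 4 1 (s + 2) j * (cosCoeff 4 1 (s + 2) j - cosCoeff 4 1 (s + 2) 0)) := by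
        intro j
        simp only [Fin.sum_univ_three, Matrix.cons_val, frogCoeff, cosCoeff_zero, cosCoeff_two]
        ring
      refine Or.inr ⟨0, 2, 2, _, htwo, by omega, by omega, by omega,
        Or.inr ⟨hB'', three _ (by omega) (by omega), ?_,
          ![1, -2 * cosCoeff 4 1 (s + 2) 0, 1], rfl⟩, ?_, ?_, Or.inr ⟨1, 2, by omega, by omega, ?_⟩⟩
      · rw [he, sub_self, mul_zero, mul_zero]
      · rw [he]
        refine mul_ne_zero two_ne_zero (mul_ne_zero ?_ (sub_ne_zero.mpr ?_))
        · rw [ne_eq, z1]; rintro ⟨k, hk⟩; omega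
        · exact cosCoeff_one_ne (by omega) (by omega) (by omega)
      · intro j h1 h2
        obtain rfl : j = 1 := by omega
        rw [he, (z1 (s + 2) 1).mpr ⟨s / 4, by omega⟩]
        ring
      · change cosCoeff 4 0 s 1 * cosCoeff 4 2 s 2 ≠ cosCoeff 4 0 s 2 * cosCoeff 4 2 s 1
        have hne : cosCoeff 4 1 s 1 ≠ 0 := by rw [ne_eq, z1]; rintro ⟨k, hk⟩; omega
        have h0 : cosCoeff 4 1 s 2 = 0 := (z1 s 2).mpr ⟨(s : ℤ) / 4 - 1, by omega⟩
        rw [cosCoeff_zero, cosCoeff_zero, cosCoeff_two, cosCoeff_two, h0]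
        intro h
        apply hne
        have : cosCoeff 4 1 s 1 ^ 2 = 0 := by linarith
        exact pow_eq_zero_iff two_ne_zero |>.mp this
  · have htwo := twoCircles_frogCoeff_one (r := 4) le_rfl (show 2 ≤ s by omega) (by
      rw [ne_eq, z1]; rintro ⟨k, hk⟩; omega)
    rcases (show s + 1 ≤ B from hB).eq_or_lt with hB' | hB'
    · exact resolvable_of_succ_eq (fun j => cosCoeff_zero _ _ _) hs hB' htwo
    · exact resolvable_frogCoeff_of_three_succ le_rfl hs hB' htwo (three _ (by omega) (by omega))
        (by omega) (by omega)

lemma resolvable_frogCoeff {r B s : ℕ} (hr : 4 ≤ r) (hs : 3 ≤ s) (hB : s < B) :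
    Resolvable B (frogCoeff r) s := by
  rcases hr.eq_or_lt with rfl | hr
  · exact resolvable_frogCoeff_four hs hB
  · exact resolvable_frogCoeff_of_five_le hr hs hB

lemma twoCircles_spectrumCoeff (r : ℕ) {s : ℕ} (hs : 2 ≤ s) :
    TwoCircles (spectrumCoeff r) 2 0 s := by
  refine ⟨?_, ?_, 1, le_rfl, by omega, ?_⟩
  · change edgeCoeff s 0 ≠ 0
    simp [edgeCoeff]
  · change cosCoeff r 0 s 0 ≠ 0
    rw [cosCoeff_zero]; exact one_ne_zero
  · change edgeCoeff s 1 * cosCoeff r 0 s 0 ≠ cosCoeff r 0 s 1 * edgeCoeff s 0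
    have : (1 : ℕ) ≠ s := by omega
    simp [cosCoeff_zero, edgeCoeff, this]

lemma threeCircles_spectrumCoeff {r s : ℕ} (hr : 3 ≤ r) (hs : 4 ≤ s)
    (h1 : cosCoeff r 1 s 0 ≠ 0) : ThreeCircles (spectrumCoeff r) s := by
  have hr0 : 0 < r := by omega
  refine ⟨?_, ?_⟩
  · intro μ
    fin_cases μ
    · change cosCoeff r 0 s 0 ≠ 0
      rw [cosCoeff_zero]; exact one_ne_zero
    · exact h1
    · change edgeCoeff s 0 ≠ 0
      simp [edgeCoeff]
  -- the third centre is the origin, so that two distinct interior coefficients suffice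
  have key : ∃ k l, (1 ≤ k ∧ k < s) ∧ (1 ≤ l ∧ l < s) ∧ cosCoeff r 1 s k ≠ cosCoeff r 1 s l := by
    by_cases d3 : (r : ℤ) ∣ (s : ℤ) - 3
    · have hle := Int.le_of_dvd (by omega) d3
      refine ⟨2, 3, by omega, by omega, cosCoeff_one_ne hr0 (fun h => ?_) fun h => ?_⟩
      · have := eq_zero_of_dvd_of_lt h (by omega) (by omega)
        omega
      · have := eq_zero_of_dvd_of_lt (dvd_sub h d3) (by omega) (by omega)
        omega
    · refine ⟨1, 2, by omega, by omega, cosCoeff_one_ne hr0 (fun h => ?_) fun h => d3 ?_⟩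
      · have := eq_zero_of_dvd_of_lt h (by omega) (by omega)
        omega
      · rwa [show (s : ℤ) - (1 : ℕ) - (2 : ℕ) = s - 3 by push_cast; ring] at h
  obtain ⟨k, l, hk, hl, hkl⟩ := key
  refine ⟨k, l, hk, hl, ?_⟩
  have ek : edgeCoeff s k = 0 := if_neg (by omega)
  have el : edgeCoeff s l = 0 := if_neg (by omega)
  have e0 : edgeCoeff s 0 = 1 := if_pos (by omega)
  have : Matrix.det (Matrix.of fun μ =>
      ![spectrumCoeff r μ s 0, spectrumCoeff r μ s k, spectrumCoeff r μ s l]) =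
      cosCoeff r 1 s l - cosCoeff r 1 s k := by
    simp only [Matrix.det_fin_three, Matrix.of_apply, Matrix.cons_val, spectrumCoeff, cosCoeff_zero,
      ek, el, e0]
    ring
  rw [this]
  exact sub_ne_zero.mpr hkl.symm

lemma resolvable_spectrumCoeff {r B s : ℕ} (hr : 3 ≤ r) (hs : 3 ≤ s) (hB : s < B) :
    Resolvable B (spectrumCoeff r) s := by
  have hr0 : 0 < r := by omega
  have htwo := twoCircles_spectrumCoeff r (show 2 ≤ s by omega)
  by_cases hreg : 4 ≤ s ∧ cosCoeff r 1 s 0 ≠ 0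
  · exact Or.inl (threeCircles_spectrumCoeff hr hreg.1 hreg.2)
  rcases (show s + 1 ≤ B from hB).eq_or_lt with hB' | hB'
  · exact resolvable_of_succ_eq (fun j => cosCoeff_zero _ _ _) hs hB' htwo
  by_cases t1 : cosCoeff r 1 (s + 1) 0 = 0
  · by_cases h3 : s = 3
    · subst h3
      exact resolvable_three hr0 hB htwo rfl t1
    · have h1 : cosCoeff r 1 s 0 = 0 := by
        by_contra h
        exact hreg ⟨by omega, h⟩
      obtain ⟨k, hk⟩ := (cosCoeff_one_eq_zero_iff hr0 s 0).mp h1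
      obtain ⟨l, hl⟩ := (cosCoeff_one_eq_zero_iff hr0 (s + 1) 0).mp t1
      have hd : (r : ℤ) ∣ 2 := ⟨2 * (l - k), by push_cast at hk hl; linarith⟩
      have := eq_zero_of_dvd_of_lt hd (by omega) (by omega)
      omega
  · have he : ∀ j, ∑ i, (![1, 0, -1] : Fin 3 → ℝ) i *
        spectrumCoeff r i (s + 1) j = 1 - edgeCoeff (s + 1) j := by
      intro j
      simp only [Fin.sum_univ_three, Matrix.cons_val, spectrumCoeff, cosCoeff_zero]
      ring
    have e0 : edgeCoeff (s + 1) 0 = 1 := if_pos (by omega)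
    have e1 : edgeCoeff (s + 1) 1 = 0 := if_neg (by omega)
    have e2 : edgeCoeff (s + 1) 2 = 0 := if_neg (by omega)
    refine Or.inr ⟨2, 0, 1, _, htwo, le_rfl, by omega, hB,
      Or.inr ⟨hB', threeCircles_spectrumCoeff hr (by omega) t1, ?_, ![1, 0, -1], rfl⟩, ?_,
      fun j h1 h2 => by omega, Or.inl ⟨2, by omega, by omega, ?_⟩⟩
    · rw [he, e0, sub_self]
    · rw [he, e1, sub_zero]; exact one_ne_zero
    · rw [he, e2, sub_zero]; exact one_ne_zero

/-! ### Recovery of signals -/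

section Recovery

variable {N : ℕ} [NeZero N]

lemma sumElim_bandSeq (B : ℕ) (i : ZMod N) (x : ZMod N → ℂ) :
    Sum.elim (fun j : Fin B => (bandSeq B i x j).re) (fun j : Fin B => (bandSeq B i x j).im) =
      bandCoords B i x := by
  funext k
  rcases k with k | k <;> simp [bandSeq, bandCoords]

lemma truncForm_cosCoeff_zero_zero (r : ℕ) (a : ℕ → ℂ) :
    truncForm (cosCoeff r 0 0) 0 0 a = a 0 * a 0 := by
  simp [truncForm, cosCoeff_zero]

lemma truncForm_cosCoeff_zero_one (r : ℕ) (a : ℕ → ℂ) :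
    truncForm (cosCoeff r 0 1) 1 0 a = 2 * (a 0 * a 1) := by
  rw [truncForm_eq_add (by omega) (cosCoeff_symm r 0 (by omega))]
  simp [truncForm, cosCoeff_zero, Complex.real_smul]

lemma truncForm_edgeCoeff {s : ℕ} (hs : 2 ≤ s) (a : ℕ → ℂ) :
    truncForm (edgeCoeff s) s 0 a = 2 * (a 0 * a s) := by
  have h0 : truncForm (edgeCoeff s) s (0 + 1) a = 0 := truncForm_eq_zero fun j h1 h2 => by
    unfold edgeCoeff
    exact if_neg (by omega)
  rw [truncForm_eq_add (by omega) (by simp [edgeCoeff]), h0]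
  simp [edgeCoeff, Complex.real_smul]

/-- Recovery within a known band from the traces at `m = 0, 1, 2`: the degrees `0` and `1` give the
moduli of the first two Fourier coefficients, the degrees `2, …, B` feed the recursion. -/
theorem exists_polynomial_frog {L B : ℕ} (hL : L ∣ N) (hB : 2 * B ≤ N) (i : ZMod N)
    (hr : 4 ≤ N / L) :
    ∃ Q : MvPolynomial (Fin B ⊕ Fin B) ℝ, Q ≠ 0 ∧ ∀ x z : ZMod N → ℂ, IsBandlimitedAt B i x →
      IsBandlimitedAt B i z → MvPolynomial.eval (bandCoords B i x) Q ≠ 0 →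
      (∀ s : ℕ, s < B → s < 2 →
        frogTrace L z (2 * i + (s : ZMod N)) 0 = frogTrace L x (2 * i + (s : ZMod N)) 0) →
      (∀ s : ℕ, 2 ≤ s → s ≤ B → ∀ m < 3,
        frogTrace L z (2 * i + (s : ZMod N)) m = frogTrace L x (2 * i + (s : ZMod N)) m) →
      TriviallyEquivalent i x z := by
  have hN := NeZero.pos N
  obtain ⟨Q, hQ0, hQ⟩ := exists_polynomial_determined_up_to (B := B) (frogCoeff_symm (N / L))
    (fun s hs _ => ⟨0, exists_twoCircles_frogCoeff hr hs⟩)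
    (fun s hs hsB => resolvable_frogCoeff hr hs hsB)
  -- the first coefficient must not vanish for the second one to be measured
  obtain ⟨R, hR0, hR⟩ : ∃ R : MvPolynomial (Fin B ⊕ Fin B) ℝ, R ≠ 0 ∧
      ∀ h : 0 < B, R = MvPolynomial.X (Sum.inl ⟨0, h⟩) := by
    by_cases h : 0 < B
    · exact ⟨MvPolynomial.X (Sum.inl ⟨0, h⟩), MvPolynomial.X_ne_zero _, fun _ => rfl⟩
    · exact ⟨1, one_ne_zero, fun h' => absurd h' h⟩
  refine ⟨Q * R, mul_ne_zero hQ0 hR0, ?_⟩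
  intro x z hx hz hne h01 h2
  rw [map_mul] at hne
  have norm_eq : ∀ s m : ℕ, s ≤ B →
      frogTrace L z (2 * i + (s : ZMod N)) m = frogTrace L x (2 * i + (s : ZMod N)) m →
      ‖truncForm (cosCoeff (N / L) m s) s 0 (bandSeq B i z)‖ =
        ‖truncForm (cosCoeff (N / L) m s) s 0 (bandSeq B i x)‖ := fun s m hs h =>
    norm_truncForm_eq_of_frogTrace_eq hL hB hx hz (by omega) h
  have n0 : ‖bandSeq B i z 0‖ = ‖bandSeq B i x 0‖ := by
    by_cases h : 0 < B
    · have := norm_eq 0 0 h.le (h01 0 h (by omega))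
      rw [truncForm_cosCoeff_zero_zero, truncForm_cosCoeff_zero_zero, norm_mul, norm_mul] at this
      exact (mul_self_inj (norm_nonneg _) (norm_nonneg _)).mp this
    · rw [bandSeq_eq_zero (by omega), bandSeq_eq_zero (by omega)]
  have n1 : ‖bandSeq B i z 1‖ = ‖bandSeq B i x 1‖ := by
    by_cases h : 1 < B
    · have := norm_eq 1 0 h.le (h01 1 h (by omega))
      rw [truncForm_cosCoeff_zero_one, truncForm_cosCoeff_zero_one] at this
      simp only [norm_mul, n0] at this
      have ha0 : ‖bandSeq B i x 0‖ ≠ 0 := by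
        have h0 := right_ne_zero_of_mul hne
        rw [hR (by omega), MvPolynomial.eval_X] at h0
        rw [norm_ne_zero_iff]
        intro hz0
        apply h0
        rw [← sumElim_bandSeq]
        simp [hz0]
      exact mul_left_cancel₀ ha0 (mul_left_cancel₀ (by simp) this)
    · rw [bandSeq_eq_zero (by omega), bandSeq_eq_zero (by omega)]
  obtain ⟨u, v, hu, hv, h⟩ := hQ (bandSeq B i x) (bandSeq B i z)
    (fun j hj => ⟨bandSeq_eq_zero hj, bandSeq_eq_zero hj⟩)
    (by rw [sumElim_bandSeq]; exact left_ne_zero_of_mul hne)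
    (fun s hs => by interval_cases s; exacts [n0, n1])
    (fun s hs hsB μ => by
      fin_cases μ
      · exact norm_eq s 0 hsB (h2 s hs hsB 0 (by omega))
      · exact norm_eq s 1 hsB (h2 s hs hsB 1 (by omega))
      · exact norm_eq s 2 hsB (h2 s hs hsB 2 (by omega)))
  exact triviallyEquivalent_of_bandSeq hB hx hz hu hv h

/-- Recovery from the power spectrum and the traces at `m = 0, 1`. -/
theorem exists_polynomial_spectrum {L B : ℕ} (hL : L ∣ N) (hB : 2 * B ≤ N) (i : ZMod N)
    (hr : 3 ≤ N / L) :
    ∃ Q : MvPolynomial (Fin B ⊕ Fin B) ℝ, Q ≠ 0 ∧ ∀ x z : ZMod N → ℂ, IsBandlimitedAt B i x →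
      MvPolynomial.eval (bandCoords B i x) Q ≠ 0 → (∀ k, ‖ZMod.dft z k‖ = ‖ZMod.dft x k‖) →
      (∀ s : ℕ, 2 ≤ s → s ≤ B → ∀ m < 2,
        frogTrace L z (2 * i + (s : ZMod N)) m = frogTrace L x (2 * i + (s : ZMod N)) m) →
      TriviallyEquivalent i x z := by
  have hN := NeZero.pos N
  obtain ⟨Q, hQ0, hQ⟩ := exists_polynomial_determined_up_to (B := B) (spectrumCoeff_symm (N / L))
    (fun s hs _ => ⟨2, 0, twoCircles_spectrumCoeff _ hs⟩)
    (fun s hs hsB => resolvable_spectrumCoeff hr hs hsB)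
  refine ⟨Q, hQ0, ?_⟩
  intro x z hx hne hspec h2
  have hz : IsBandlimitedAt B i z := fun j h1 h2 => by
    rw [← norm_eq_zero, hspec, hx j h1 h2, norm_zero]
  have norm_eq : ∀ s m : ℕ, s ≤ B →
      frogTrace L z (2 * i + (s : ZMod N)) m = frogTrace L x (2 * i + (s : ZMod N)) m →
      ‖truncForm (cosCoeff (N / L) m s) s 0 (bandSeq B i z)‖ =
        ‖truncForm (cosCoeff (N / L) m s) s 0 (bandSeq B i x)‖ := fun s m hs h =>
    norm_truncForm_eq_of_frogTrace_eq hL hB hx hz (by omega) h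
  have hband : ∀ j, ‖bandSeq B i z j‖ = ‖bandSeq B i x j‖ := by
    intro j
    unfold bandSeq
    split_ifs
    · exact hspec _
    · rfl
  obtain ⟨u, v, hu, hv, h⟩ := hQ (bandSeq B i x) (bandSeq B i z)
    (fun j hj => ⟨bandSeq_eq_zero hj, bandSeq_eq_zero hj⟩)
    (by rw [sumElim_bandSeq]; exact hne)
    (fun s _ => hband s)
    (fun s hs hsB μ => by
      fin_cases μ
      · exact norm_eq s 0 hsB (h2 s hs hsB 0 (by omega))
      · exact norm_eq s 1 hsB (h2 s hs hsB 1 (by omega))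
      · change ‖truncForm (edgeCoeff s) s 0 _‖ = ‖truncForm (edgeCoeff s) s 0 _‖
        rw [truncForm_edgeCoeff hs, truncForm_edgeCoeff hs]
        simp only [norm_mul, hband])
  exact triviallyEquivalent_of_bandSeq hB hx hz hu hv h

/-- For generic signals the trace at `m = 0` does not vanish on the doubled band. -/
lemma exists_polynomial_frogTrace_ne_zero {L B : ℕ} (hL : L ∣ N) (hB : 2 * B ≤ N) (i : ZMod N) :
    ∃ Q : MvPolynomial (Fin B ⊕ Fin B) ℝ, Q ≠ 0 ∧ ∀ x : ZMod N → ℂ, IsBandlimitedAt B i x →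
      MvPolynomial.eval (bandCoords B i x) Q ≠ 0 →
      ∀ s : ℕ, s + 1 < 2 * B → frogTrace L x (2 * i + (s : ZMod N)) 0 ≠ 0 := by
  have hpoly : ∀ s ∈ Finset.range (2 * B - 1),
      truncForm (cosCoeff (N / L) 0 s) s 0 (genSeq B) ≠ 0 := by
    intro s hs h0
    rw [Finset.mem_range] at hs
    set q := min s (B - 1) with hq
    obtain ⟨n, hn, h⟩ := exists_truncForm_eq_mul (t := s) (p := 0) (q := q)
      (a := indicatorSeq [q, s - q]) (by omega) (by omega) (by
        intro j _ hj
        simp only [indicatorSeq, List.mem_cons, List.not_mem_nil, or_false]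
        split_ifs <;> first | (norm_num; done) | (exfalso; omega))
    have hz := indicatorSeq_eq_zero (B := B) (l := [q, s - q]) (by simp; omega)
    have h1 := congrArg (specialize B (indicatorSeq [q, s - q]) 0) h0
    rw [map_truncForm, map_zero] at h1
    simp only [specialize_genSeq hz] at h1
    rw [h _ (cosCoeff_symm _ _ (by omega)), cosCoeff_zero, mul_one] at h1
    exact hn h1
  obtain ⟨Q, hQ0, hQ⟩ := exists_real_polynomial (Finset.prod_ne_zero_iff.mpr hpoly)
  refine ⟨Q, hQ0, ?_⟩
  intro x hx hne s hs
  rw [← sumElim_bandSeq] at hne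
  have h1 := hQ (fun j : Fin B => bandSeq B i x j) hne
  rw [map_prod, Finset.prod_ne_zero_iff] at h1
  have h2 := h1 s (Finset.mem_range.mpr (by omega))
  rw [map_truncForm] at h2
  have h3 : ∀ j, MvPolynomial.aeval (Sum.elim (fun j : Fin B => bandSeq B i x j)
      fun j : Fin B => (starRingEnd ℂ) (bandSeq B i x j)) (genSeq B j) = bandSeq B i x j := by
    intro j
    unfold genSeq
    split_ifs with h
    · simp
    · rw [map_zero, bandSeq_eq_zero (not_lt.mp h)]
  simp only [h3] at h2
  rw [frogTrace_eq hL hB hx (by omega)]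
  have hN : (N : ℝ) ≠ 0 := Nat.cast_ne_zero.mpr (NeZero.ne N)
  exact pow_ne_zero _ (mul_ne_zero (inv_ne_zero hN) (norm_ne_zero_iff.mpr h2))

lemma frogTrace_eq_zero_of_le {L B : ℕ} (hL : L ∣ N) (hB : 2 * B ≤ N) {j : ZMod N}
    {z : ZMod N → ℂ} (hz : IsBandlimitedAt B j z) {s : ℕ} (hs : 2 * B ≤ s + 1) (hsN : s < N)
    (m : ℕ) : frogTrace L z (2 * j + (s : ZMod N)) m = 0 := by
  have : truncForm (cosCoeff (N / L) m s) s 0 (bandSeq B j z) = 0 := by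
    unfold truncForm
    refine Finset.sum_eq_zero fun l hl => ?_
    by_cases h : B ≤ l
    · rw [bandSeq_eq_zero h, zero_mul, smul_zero]
    · rw [bandSeq_eq_zero (j := s - l) (by omega), mul_zero, smul_zero]
  rw [frogTrace_eq hL hB hz hsN, this]
  simp

/-- An arc of length `2 B - 1 < N` on which the trace does not vanish determines the doubled start
of the band. -/
lemma two_mul_eq_of_frogTrace_ne_zero {L B : ℕ} (hL : L ∣ N) (hB : 2 * B ≤ N) (hB0 : 0 < B)
    {i j : ZMod N} {x z : ZMod N → ℂ} (hz : IsBandlimitedAt B j z)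
    (hx : ∀ s : ℕ, s + 1 < 2 * B → frogTrace L x (2 * i + (s : ZMod N)) 0 ≠ 0)
    (h : ∀ k, frogTrace L z k 0 = frogTrace L x k 0) : 2 * j = 2 * i := by
  set d := (2 * i - 2 * j).val with hd
  have hdN : d < N := ZMod.val_lt _
  have hij : 2 * i = 2 * j + (d : ZMod N) := by simp [hd]
  by_cases hd0 : d = 0
  · rw [hij, hd0]; simp
  exfalso
  have hdB : d + 1 < 2 * B := by
    by_contra hcon
    apply hx 0 (by omega)
    rw [← h, hij, Nat.cast_zero, add_zero]
    exact frogTrace_eq_zero_of_le hL hB hz (by omega) hdN 0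
  apply hx (2 * B - 1 - d) (by omega)
  rw [← h, hij, add_assoc, ← Nat.cast_add, show d + (2 * B - 1 - d) = 2 * B - 1 by omega]
  exact frogTrace_eq_zero_of_le hL hB hz (by omega) (by omega) 0

end Recovery

lemma exists_indices_degree_ge_two {N : ℕ} (B M : ℕ) (c : ZMod N) :
    ∃ S : Finset (ZMod N × ℕ), S.card ≤ M * (B - 1) ∧ (∀ p ∈ S, p.2 < M) ∧
      ∀ s : ℕ, 2 ≤ s → s ≤ B → ∀ m < M, (c + (s : ZMod N), m) ∈ S := by
  classical
  refine ⟨((Finset.Icc 2 B).image fun s : ℕ => c + (s : ZMod N)) ×ˢ Finset.range M, ?_, ?_, ?_⟩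
  · rw [Finset.card_product, Finset.card_range, mul_comm]
    refine Nat.mul_le_mul_left M (Finset.card_image_le.trans ?_)
    rw [Nat.card_Icc]
    omega
  · intro p hp
    exact Finset.mem_range.mp (Finset.mem_product.mp hp).2
  · intro s hs hsB m hm
    exact Finset.mk_mem_product
      (Finset.mem_image_of_mem (fun s : ℕ => c + (s : ZMod N)) (Finset.mem_Icc.mpr ⟨hs, hsB⟩))
      (Finset.mem_range.mpr hm)

lemma exists_indices_degree_lt_two {N : ℕ} (B : ℕ) (c : ZMod N) :
    ∃ S : Finset (ZMod N × ℕ), S.card ≤ min B 2 ∧ (∀ p ∈ S, p.2 = 0) ∧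
      ∀ s : ℕ, s < B → s < 2 → (c + (s : ZMod N), 0) ∈ S := by
  classical
  refine ⟨((Finset.range (min B 2)).image fun s : ℕ => c + (s : ZMod N)) ×ˢ {0}, ?_, ?_, ?_⟩
  · rw [Finset.card_product, Finset.card_singleton, mul_one]
    exact Finset.card_image_le.trans (Finset.card_range _).le
  · intro p hp
    exact Finset.mem_singleton.mp (Finset.mem_product.mp hp).2
  · intro s hsB hs
    exact Finset.mk_mem_product (Finset.mem_image_of_mem (fun s : ℕ => c + (s : ZMod N))
      (Finset.mem_range.mpr (lt_min hsB hs))) (Finset.mem_singleton_self 0)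

theorem theorem1 (N L B : ℕ) [NeZero N] (hL : L ∣ N) (hB : 2 * B ≤ N) (i : ZMod N) :
    (4 ≤ N / L →
      (∃ S : Finset (ZMod N × ℕ), S.card ≤ 3 * B ∧ (∀ p ∈ S, p.2 < 3) ∧
        HoldsGenerically B i (fun x =>
          ∀ z : ZMod N → ℂ, IsBandlimitedAt B i z →
            (∀ p ∈ S, frogTrace L z p.1 p.2 = frogTrace L x p.1 p.2) →
              TriviallyEquivalent i x z)) ∧
      HoldsGenerically B i (fun x =>
        ∀ (j : ZMod N) (z : ZMod N → ℂ), IsBandlimitedAt B j z → (2 * j = 2 * i → j = i) →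
          (∀ (k : ZMod N) (m : ℕ), m < 3 → frogTrace L z k m = frogTrace L x k m) →
            TriviallyEquivalent i x z)) ∧
    (3 ≤ N / L →
      ∃ S : Finset (ZMod N × ℕ), S.card ≤ 2 * B ∧ (∀ p ∈ S, p.2 < 2) ∧
        HoldsGenerically B i (fun x =>
          ∀ z : ZMod N → ℂ, (∀ k : ZMod N, ‖ZMod.dft z k‖ = ‖ZMod.dft x k‖) →
            (∀ p ∈ S, frogTrace L z p.1 p.2 = frogTrace L x p.1 p.2) →
              TriviallyEquivalent i x z)) := by
  classical
  refine ⟨fun hr => ?_, fun hr => ?_⟩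
  · obtain ⟨Q, hQ0, hQ⟩ := exists_polynomial_frog hL hB i hr
    obtain ⟨S₁, hcard₁, hlt₁, hmem₁⟩ := exists_indices_degree_lt_two B (2 * i)
    obtain ⟨S₂, hcard₂, hlt₂, hmem₂⟩ := exists_indices_degree_ge_two B 3 (2 * i)
    refine ⟨⟨S₁ ∪ S₂, ?_, ?_, Q, hQ0, ?_⟩, ?_⟩
    · have := Finset.card_union_le S₁ S₂
      omega
    · intro p hp
      rcases Finset.mem_union.mp hp with h | h
      · have := hlt₁ p h
        omega
      · exact hlt₂ p h
    · intro x hx hnot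
      by_contra hne
      refine hnot fun z hz hS => hQ x z hx hz hne (fun s hsB hs2 => ?_) fun s hs hsB m hm => ?_
      · exact hS (2 * i + (s : ZMod N), 0) (Finset.mem_union_left _ (hmem₁ s hsB hs2))
      · exact hS (2 * i + (s : ZMod N), m) (Finset.mem_union_right _ (hmem₂ s hs hsB m hm))
    · obtain ⟨R, hR0, hR⟩ := exists_polynomial_frogTrace_ne_zero hL hB i
      refine ⟨Q * R, mul_ne_zero hQ0 hR0, fun x hx hnot => ?_⟩
      by_contra hne
      rw [map_mul] at hne
      refine hnot fun j z hz hij hall => ?_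
      have hz' : IsBandlimitedAt B i z := by
        rcases Nat.eq_zero_or_pos B with rfl | hB0
        · -- without free coefficients every band describes the zero signal only
          intro l _ _
          have := hz (i + (l : ZMod N) - j).val (Nat.zero_le _) (ZMod.val_lt _)
          simpa using this
        · have := two_mul_eq_of_frogTrace_ne_zero hL hB hB0 hz
            (hR x hx (right_ne_zero_of_mul hne)) fun k => hall k 0 (by omega)
          rw [← hij this]
          exact hz
      exact hQ x z hx hz' (left_ne_zero_of_mul hne) (fun s _ _ => hall _ 0 (by omega))
        fun s _ _ m hm => hall _ m hm
  · obtain ⟨Q, hQ0, hQ⟩ := exists_polynomial_spectrum hL hB i hr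
    obtain ⟨S, hcard, hlt, hmem⟩ := exists_indices_degree_ge_two B 2 (2 * i)
    refine ⟨S, hcard.trans (by omega), hlt, Q, hQ0, ?_⟩
    intro x hx hnot
    by_contra hne
    refine hnot fun z hspec hS => hQ x z hx hne hspec fun s hs hsB m hm => ?_
    exact hS (2 * i + (s : ZMod N), m) (hmem s hs hsB m hm)
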